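/- **Notation.** Let $\mathbb H$ be the real quaternions, $\mathbf A^*$ the conjugate transpose of a quaternion matrix $\mathbf A$, $\|\cdot\|$ the Frobenius norm, and $\operatorname{rank}\mathbf A$ the dimension of the right $\mathbb H$-vector space spanned by the columns of $\mathbf A$. For a square matrix $\mathbf M=(m_{pq})$ whose rows and columns are indexed by a finite totally ordered set $I$, and for $i\in I$, the $i$th column determinant is $$\operatorname{cdet}_i\mathbf M=\sum_{\tau}(-1)^{|I|-c(\tau)}\,\pi_{c(\tau)}(\tau)\cdots\pi_2(\tau)\,\pi_1(\tau),$$ where $\tau$ runs over the permutations of $I$, $c(\tau)$ is the number of cycles of $\tau$ (fixed points included), and the factors are as follows. For $x\in I$ in a cycle of length $\ell$, the cycle monomial opened by $x$ is $m_{x,\,\tau^{\ell-1}x}\cdots m_{\tau^2x,\,\tau x}\,m_{\tau x,\,x}$ (for a fixed point, $m_{xx}$). Then $\pi_1(\tau)$ is the monomial, opened by $i$, of the cycle containing $i$; and $\pi_2(\tau),\dots,\pi_{c(\tau)}(\tau)$ are the monomials of the other cycles, each opened by its least element, ordered so that these least elements increase with the subscript. For a Hermitian matrix $\mathbf H$ all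 the column determinants coincide and are real; their common value is $\det\mathbf H$, and the empty matrix has determinant $1$. For any $\mathbf A\in\mathbb H^{m\times n}$ put $\operatorname{ddet}\mathbf A=\det(\mathbf A^*\mathbf A)$. For $\beta\subseteq\{1,\dots,n\}$, $\mathbf M_\beta^\beta$ is the principal submatrix with rows and columns in $\beta$, which keep their original labels, and $|\mathbf H_\beta^\beta|=\det\mathbf H_\beta^\beta$ for Hermitian $\mathbf H$. Let $J_{r,n}$ be the set of $r$-element subsets of $\{1,\dots,n\}$ and $J_{r,n}\{i\}=\{\beta\in J_{r,n}: i\in\beta\}$. Let $\mathbf M_{.i}(\mathbf b)$ be $\mathbf M$ with its $i$th column replaced by the column $\mathbf b$. The Moore–Penrose inverse $\mathbf A^+$ is the matrix satisfying $(\mathbf A\mathbf A^+)^*=\mathbf A\mathbf A^+$, $(\mathbf A^+\mathbf A)^*=\mathbf A^+\mathbf A$, $\mathbf A\mathbf A^+\mathbf A=\mathbf A$, $\mathbf A^+\mathbf A\mathbf A^+=\mathbf A^+$. A least squares solution of $\mathbf A\mathbf X=\mathbf B$ is an $\mathbf X$ minimizing $\|\mathbf A\mathbf X-\mathbf B\|$,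 and a minimum norm least squares solution is a least squares solution of least norm. **Theorem 4.2.** Let $\mathbf A\in\mathbb H^{m\times n}$ and $\mathbf B\in\mathbb H^{m\times s}$, and let $\hat{\mathbf b}_{.j}$ be the $j$th column of $\hat{\mathbf B}=\mathbf A^*\mathbf B$. The Moore–Penrose inverse $\mathbf A^+$ and the minimum norm least squares solution $\mathbf X_{LS}=(x_{ij})\in\mathbb H^{n\times s}$ of $\mathbf A\mathbf X=\mathbf B$ exist and are unique, and $\mathbf X_{LS}=\mathbf A^+\mathbf B$. Moreover: (i) If $\operatorname{rank}\mathbf A=r\le m<n$, then $\sum_{\beta\in J_{r,n}}|(\mathbf A^*\mathbf A)_\beta^\beta|$ is a nonzero real number and, for all $i=1,\dots,n$ and $j=1,\dots,s$, $$x_{ij}=\frac{\sum_{\beta\in J_{r,n}\{i\}}\operatorname{cdet}_i\Bigl(\bigl((\mathbf A^*\mathbf A)_{.i}(\hat{\mathbf b}_{.j})\bigr)_\beta^\beta\Bigr)}{\sum_{\beta\in J_{r,n}}\bigl|(\mathbf A^*\mathbf A)_\beta^\beta\bigr|}.$$ (ii) If $\operatorname{rank}\mathbf A=n$, then $\operatorname{ddet}\mathbf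 A$ is a nonzero real number and, for all $i=1,\dots,n$ and $j=1,\dots,s$, $$x_{ij}=\frac{\operatorname{cdet}_i\bigl((\mathbf A^*\mathbf A)_{.i}(\hat{\mathbf b}_{.j})\bigr)}{\operatorname{ddet}\mathbf A}.$$ -/

import Mathlib

open scoped Matrix Quaternion

/-- The length of the cycle of `τ` through `x` (it is `1` when `x` is a fixed point). -/
def cycleLength {ι : Type*} [Fintype ι] [LinearOrder ι] (τ : Equiv.Perm ι) (x : ι) : ℕ :=
  (Finset.univ.filter fun y => τ.SameCycle x y).card

/-- The monomial `a_{x, τˡ x} ⋯ a_{τ² x, τ x} a_{τ x, x}` of the cycle `(τˡ x … τ x x)` of `τ`,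
written so that the cycle opens with `x` from the right; here `l + 1` is the cycle's length. -/
def colCycleProd {R ι : Type*} [Ring R] [Fintype ι] [LinearOrder ι]
    (A : Matrix ι ι R) (τ : Equiv.Perm ι) (x : ι) : R :=
  ((List.range (cycleLength τ x)).reverse.map
    fun t => A ((τ ^ (t + 1)) x) ((τ ^ t) x)).prod

/-- The least elements of the cycles of `τ` (fixed points included) that do not contain `j`,
in increasing order. -/
def otherCycleHeads {ι : Type*} [Fintype ι] [LinearOrder ι] (τ : Equiv.Perm ι) (j : ι) : List ι :=
  (Finset.univ.filter fun x =>
    ¬ τ.SameCycle j x ∧ ∀ y, τ.SameCycle x y → x ≤ y).sort (· ≤ ·)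

/-- The `j`th column determinant of a square matrix over a possibly noncommutative ring.
In the monomial of `τ` the cycle through `j` stands rightmost and opens with `j` from the right;
every other cycle opens from the right with its least element, and from right to left these least
elements increase. The sign of `τ` is `(-1) ^ (n - r)` with `r` the number of cycles of `τ`, fixed
points included. -/
def cdet {R ι : Type*} [Ring R] [Fintype ι] [LinearOrder ι] (A : Matrix ι ι R) (j : ι) : R :=
  ∑ τ : Equiv.Perm ι, ((Equiv.Perm.sign τ : ℤ) : R) *
    (((otherCycleHeads τ j).reverse.map (colCycleProd A τ)).prod * colCycleProd A τ j)

/-- The determinant of a Hermitian quaternion matrix, used here for Hermitian matrices only. For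
these all the column determinants agree; the one at the least index is taken. The empty matrix has
determinant `1`. -/
noncomputable def hermDet {ι : Type*} [Fintype ι] [LinearOrder ι] (H : Matrix ι ι ℍ[ℝ]) : ℍ[ℝ] :=
  if h : (Finset.univ : Finset ι).Nonempty then cdet H (Finset.univ.min' h) else 1

/-- The principal submatrix with rows and columns indexed by `β`. -/
def principalSubmatrix {R ι : Type*} (A : Matrix ι ι R) (β : Finset ι) : Matrix β β R :=
  A.submatrix Subtype.val Subtype.val

/-- The double determinant `det (A* A)`, for a not necessarily square `A`. -/
noncomputable def ddet {m n : ℕ} (A : Matrix (Fin m) (Fin n) ℍ[ℝ]) : ℍ[ℝ] :=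
  hermDet (Aᴴ * A)

/-- The rank of a quaternion matrix: the dimension of the right vector space spanned by its
columns. A right `ℍ`-vector space is a module over the opposite ring. -/
noncomputable def quatRank {m n : ℕ} (A : Matrix (Fin m) (Fin n) ℍ[ℝ]) : ℕ :=
  Module.finrank ℍ[ℝ]ᵐᵒᵖ (Submodule.span ℍ[ℝ]ᵐᵒᵖ (Set.range fun j : Fin n => fun i => A i j))

/-- `P` satisfies the four Penrose conditions, i.e. `P` is the Moore–Penrose inverse of `A`. -/
structure IsMoorePenroseInverse {m n : ℕ} (A : Matrix (Fin m) (Fin n) ℍ[ℝ])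
    (P : Matrix (Fin n) (Fin m) ℍ[ℝ]) : Prop where
  conj_left : (A * P)ᴴ = A * P
  conj_right : (P * A)ᴴ = P * A
  mul_mul_self : A * P * A = A
  self_mul_mul : P * A * P = P

section LeastSquares

attribute [local instance] Matrix.frobeniusNormedAddCommGroup

/-- `X` is a least squares solution of `A X = B` (`‖·‖` is the Frobenius norm). -/
def IsLeastSquaresSolution {m n s : ℕ} (A : Matrix (Fin m) (Fin n) ℍ[ℝ])
    (B : Matrix (Fin m) (Fin s) ℍ[ℝ]) (X : Matrix (Fin n) (Fin s) ℍ[ℝ]) : Prop :=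
  ∀ Y : Matrix (Fin n) (Fin s) ℍ[ℝ], ‖A * X - B‖ ≤ ‖A * Y - B‖

/-- `X` is a least squares solution of `A X = B` of minimum Frobenius norm. -/
def IsMinNormLeastSquaresSolution {m n s : ℕ} (A : Matrix (Fin m) (Fin n) ℍ[ℝ])
    (B : Matrix (Fin m) (Fin s) ℍ[ℝ]) (X : Matrix (Fin n) (Fin s) ℍ[ℝ]) : Prop :=
  IsLeastSquaresSolution A B X ∧
    ∀ Y : Matrix (Fin n) (Fin s) ℍ[ℝ], IsLeastSquaresSolution A B Y → ‖X‖ ≤ ‖Y‖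

end LeastSquares

/-- The sum of all principal minors of order `r` of a Hermitian matrix. -/
noncomputable def sumPrincipalMinors {n : ℕ} (r : ℕ) (H : Matrix (Fin n) (Fin n) ℍ[ℝ]) : ℍ[ℝ] :=
  ∑ β : {β : Finset (Fin n) // β.card = r}, hermDet (principalSubmatrix H β.1)

/-- The sum of `cdet_i (M^β_β)` over the sets `β` of `r` indices with `i ∈ β`. -/
def sumPrincipalCdet {R : Type*} [Ring R] {n : ℕ} (r : ℕ) (M : Matrix (Fin n) (Fin n) R)
    (i : Fin n) : R :=
  ∑ β : {β : Finset (Fin n) // β.card = r ∧ i ∈ β},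
    cdet (principalSubmatrix M β.1) ⟨i, β.2.2⟩

/-! Write $H=A^*A$. In each monomial of $\operatorname{cdet}_i$ the entry from column $i$ stands
rightmost, so $\operatorname{cdet}_i$ depends on column $i$ through left coefficients, the
cofactors. Removing an index from a cycle turns an off-diagonal cofactor into a column determinant
on one index fewer. For positive definite $H$, induction on the index set then gives Cramer's rule:
replacing column $i$ by $Hx$ yields $d\,x_i$, with $d>0$ the determinant (`PosDefOn.exists_det`).
Letting $t\to0^+$ in $A^*A+tI$ extends it to Gram matrices with $d\ge0$ (`exists_det_gram`).

The minimum norm least squares solution is $X=A^+B$; its columns satisfy $Hx=\hat b$ and $x=A^*w$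
for some $w$. At full column rank Cramer's rule finishes. At rank $r$, expand $Hx$ by columns in
each $\operatorname{cdet}_i$ over an $r$-set $\beta\ni i$: columns inside $\beta$ contribute
$|H_\beta^\beta|x_i$. The remaining terms, regrouped by $\delta=\beta\cup\{l\}$, add up to
$|H_{\delta\setminus i}^{\delta\setminus i}|x_i$, because minors of order $r+1$ vanish and $x=A^*w$.
These supply the sets not containing $i$ (`sum_cdetOn_gram_updateCol`). -/

/-! ### Column determinants over subsets of indices, and their cofactors. -/

section ColumnDeterminant

variable {R ι : Type*} [Ring R]

/-- The product `A (τᵏ x) (τᵏ⁻¹ x) ⋯ A (τ x) x` along `k` steps of `τ`. -/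
def pathProd (A : Matrix ι ι R) (τ : Equiv.Perm ι) (k : ℕ) (x : ι) : R :=
  ((List.range k).reverse.map fun t => A ((τ ^ (t + 1)) x) ((τ ^ t) x)).prod

theorem pathProd_succ (A : Matrix ι ι R) (τ : Equiv.Perm ι) (k : ℕ) (x : ι) :
    pathProd A τ (k + 1) x = pathProd A τ k (τ x) * A (τ x) x := by
  simp only [pathProd, List.range_succ_eq_map, List.reverse_cons, List.map_append, List.map_cons,
    List.map_nil, List.prod_append, List.prod_singleton, pow_zero, zero_add, pow_one,
    Equiv.Perm.one_apply, ← List.map_reverse, List.map_map]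
  congr 3

theorem pathProd_congr {A A' : Matrix ι ι R} {τ τ' : Equiv.Perm ι} {k : ℕ} {x x' : ι}
    (h : ∀ t < k, A ((τ ^ (t + 1)) x) ((τ ^ t) x) = A' ((τ' ^ (t + 1)) x') ((τ' ^ t) x')) :
    pathProd A τ k x = pathProd A' τ' k x' := by
  unfold pathProd
  congr 1
  apply List.map_congr_left
  intro t ht
  exact h t (by simpa using ht)

theorem ofSubtype_pow_apply [DecidableEq ι] (β : Finset ι) (τ : Equiv.Perm β) (t : ℕ) (x : β) :
    (Equiv.Perm.ofSubtype τ ^ t) (x : ι) = ((τ ^ t) x : β) := by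
  rw [← map_pow, Equiv.Perm.ofSubtype_apply_coe]

theorem sameCycle_ofSubtype [DecidableEq ι] (β : Finset ι) (τ : Equiv.Perm β) (x y : β) :
    (Equiv.Perm.ofSubtype τ).SameCycle (x : ι) y ↔ τ.SameCycle x y := by
  unfold Equiv.Perm.SameCycle
  simp_rw [← map_zpow, Equiv.Perm.ofSubtype_apply_coe, Subtype.coe_inj]

theorem contract_apply [DecidableEq ι] {τ τ' : Equiv.Perm ι} {i l : ι}
    (h : τ' = τ * Equiv.swap i l) {x : ι} (hxi : x ≠ i) (hxl : x ≠ l) :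
    τ x = τ' x := by
  rw [h, Equiv.Perm.mul_apply, Equiv.swap_apply_of_ne_of_ne hxi hxl]

/-- When `τ i = l`, the permutation `τ * swap i l` sends `i` to `τ l` and fixes `l`: it cuts `l` out
of its cycle and leaves every other cycle alone. -/
theorem contract_pow_apply_of_not_sameCycle [DecidableEq ι] {τ τ' : Equiv.Perm ι} {i l : ι}
    (h : τ' = τ * Equiv.swap i l)
    (hl : τ i = l) {x : ι} (hx : ¬ τ'.SameCycle i x) (hxl : x ≠ l) (t : ℕ) :
    (τ ^ t) x = (τ' ^ t) x := by
  have hl' : τ' l = l := by rw [h]; simp [hl]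
  induction t with
  | zero => rfl
  | succ t ih =>
    rw [pow_succ', pow_succ', Equiv.Perm.mul_apply, Equiv.Perm.mul_apply, ih]
    apply contract_apply h
    · intro hc
      exact hx (hc ▸ Equiv.Perm.sameCycle_pow_left.2 (Equiv.Perm.SameCycle.refl _ _))
    · intro hc
      have : τ'.SameCycle l x := hc ▸ Equiv.Perm.sameCycle_pow_left.2
        (Equiv.Perm.SameCycle.refl _ _)
      exact hxl (this.eq_of_left hl').symm

variable [Fintype ι] [LinearOrder ι]

theorem cycleLength_eq_minimalPeriod (τ : Equiv.Perm ι) (x : ι) :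
    cycleLength τ x = Function.minimalPeriod τ x := by
  classical
  have h := MulAction.minimalPeriod_eq_card τ x
  have h' : (fun y => τ • y) = τ := rfl
  rw [h'] at h
  rw [h, cycleLength, ← Set.toFinset_card]
  congr 1
  ext y
  simp only [Finset.mem_filter, Finset.mem_univ, true_and, Set.mem_toFinset,
    MulAction.mem_orbit_iff, Subtype.exists, Subgroup.mem_zpowers_iff]
  constructor
  · rintro ⟨k, hk⟩
    exact ⟨τ ^ k, ⟨k, rfl⟩, hk⟩
  · rintro ⟨_, ⟨k, rfl⟩, hk⟩
    exact ⟨k, hk⟩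

theorem cycleLength_pos (τ : Equiv.Perm ι) (x : ι) : 0 < cycleLength τ x :=
  Finset.card_pos.2 ⟨x, by simp [Equiv.Perm.SameCycle.refl]⟩

theorem pow_cycleLength_apply (τ : Equiv.Perm ι) (x : ι) : (τ ^ cycleLength τ x) x = x := by
  rw [cycleLength_eq_minimalPeriod, Equiv.Perm.coe_pow]
  exact Function.iterate_minimalPeriod

theorem pow_apply_ne_self (τ : Equiv.Perm ι) (x : ι) {k : ℕ} (hk : 0 < k)
    (hk' : k < cycleLength τ x) : (τ ^ k) x ≠ x := by
  rw [cycleLength_eq_minimalPeriod] at hk'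
  rw [Equiv.Perm.coe_pow]
  exact Function.not_isPeriodicPt_of_pos_of_lt_minimalPeriod hk.ne' hk'

theorem colCycleProd_eq_pathProd (A : Matrix ι ι R) (τ : Equiv.Perm ι) (x : ι) :
    colCycleProd A τ x = pathProd A τ (cycleLength τ x) x := rfl

/-- Permutations of `ι` that fix the complement of `β`. -/
def permsOn (β : Finset ι) : Finset (Equiv.Perm ι) :=
  Finset.univ.filter fun τ => ∀ x, x ∉ β → τ x = x

theorem mem_permsOn {β : Finset ι} {τ : Equiv.Perm ι} :
    τ ∈ permsOn β ↔ ∀ x, x ∉ β → τ x = x := by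
  simp [permsOn]

theorem apply_mem_of_mem_permsOn {β : Finset ι} {τ : Equiv.Perm ι} (h : τ ∈ permsOn β) {x : ι}
    (hx : x ∈ β) : τ x ∈ β := by
  by_contra h'
  have h1 := mem_permsOn.1 h _ h'
  rw [τ.injective h1] at h'
  exact h' hx

/-- The least elements of the cycles of `τ` in `β` that do not contain `j`. -/
def cycleHeadsOn (β : Finset ι) (τ : Equiv.Perm ι) (j : ι) : Finset ι :=
  β.filter fun x => ¬ τ.SameCycle j x ∧ ∀ y, τ.SameCycle x y → x ≤ y

/-- The product of the monomials of the cycles of `τ` opened by the elements of `s`. -/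
def headsProd (A : Matrix ι ι R) (τ : Equiv.Perm ι) (s : Finset ι) : R :=
  (s.sort.reverse.map (colCycleProd A τ)).prod

theorem headsProd_congr {A A' : Matrix ι ι R} {τ τ' : Equiv.Perm ι} {s : Finset ι}
    (h : ∀ x ∈ s, colCycleProd A τ x = colCycleProd A' τ' x) :
    headsProd A τ s = headsProd A' τ' s := by
  unfold headsProd
  congr 1
  apply List.map_congr_left
  intro x hx
  exact h x (by simpa using hx)

/-- The column determinant of the principal submatrix on `β`, as a sum over permutations
of the whole index set. -/
def cdetOn (β : Finset ι) (A : Matrix ι ι R) (j : ι) : R :=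
  ∑ τ ∈ permsOn β, ((Equiv.Perm.sign τ : ℤ) : R) *
    (headsProd A τ (cycleHeadsOn β τ j) * colCycleProd A τ j)

/-- The determinant of the principal submatrix on `β`, with all cycles opened by their
least elements. -/
def detOn (β : Finset ι) (A : Matrix ι ι R) : R :=
  ∑ τ ∈ permsOn β, ((Equiv.Perm.sign τ : ℤ) : R) *
    headsProd A τ (β.filter fun x => ∀ y, τ.SameCycle x y → x ≤ y)

theorem cdet_eq_cdetOn_univ (A : Matrix ι ι R) (j : ι) : cdet A j = cdetOn Finset.univ A j := by
  unfold cdet cdetOn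
  apply Finset.sum_congr
  · ext; simp [permsOn]
  · intros; rfl

theorem sameCycle_mem {β : Finset ι} {τ : Equiv.Perm ι} (h : τ ∈ permsOn β) {x y : ι}
    (hx : x ∈ β) (hxy : τ.SameCycle x y) : y ∈ β := by
  by_contra hy
  have := hxy.eq_of_right (mem_permsOn.1 h y hy)
  exact hy (this ▸ hx)

theorem ofSubtype_mem_permsOn (β : Finset ι) (τ : Equiv.Perm β) :
    Equiv.Perm.ofSubtype τ ∈ permsOn β :=
  mem_permsOn.2 fun _ hx => Equiv.Perm.ofSubtype_apply_of_not_mem τ hx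

theorem cycleLength_ofSubtype (β : Finset ι) (τ : Equiv.Perm β) (x : β) :
    cycleLength (Equiv.Perm.ofSubtype τ) (x : ι) = cycleLength τ x := by
  unfold cycleLength
  rw [← Finset.card_map (Function.Embedding.subtype _)]
  congr 1
  ext y
  simp only [Finset.mem_filter, Finset.mem_univ, true_and, Finset.mem_map,
    Function.Embedding.coe_subtype, Subtype.exists, exists_and_right, exists_eq_right]
  constructor
  · intro h
    have hy := sameCycle_mem (ofSubtype_mem_permsOn β τ) x.2 h
    exact ⟨hy, (sameCycle_ofSubtype β τ x ⟨y, hy⟩).1 h⟩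
  · rintro ⟨hy, h⟩
    exact (sameCycle_ofSubtype β τ x ⟨y, hy⟩).2 h

theorem colCycleProd_ofSubtype (β : Finset ι) (A : Matrix ι ι R) (τ : Equiv.Perm β) (x : β) :
    colCycleProd (principalSubmatrix A β) τ x = colCycleProd A (Equiv.Perm.ofSubtype τ) x := by
  simp only [colCycleProd, cycleLength_ofSubtype, ofSubtype_pow_apply, principalSubmatrix,
    Matrix.submatrix_apply]

theorem otherCycleHeads_map (β : Finset ι) (τ : Equiv.Perm β) (j : β) :
    (otherCycleHeads τ j).map Subtype.val =
      (cycleHeadsOn β (Equiv.Perm.ofSubtype τ) j).sort := by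
  have h := Finset.map_sort (r := (· ≤ ·)) (r' := (· ≤ ·)) (Function.Embedding.subtype (· ∈ β))
    (Finset.univ.filter fun x => ¬ τ.SameCycle j x ∧ ∀ y, τ.SameCycle x y → x ≤ y)
    (fun _ _ _ _ => Iff.rfl)
  unfold otherCycleHeads
  refine Eq.trans h ?_
  congr 1
  ext x
  simp only [Finset.mem_map, Finset.mem_filter, Finset.mem_univ, true_and, cycleHeadsOn,
    Function.Embedding.coe_subtype]
  constructor
  · rintro ⟨x, ⟨h1, h2⟩, rfl⟩
    refine ⟨x.2, fun h => h1 ((sameCycle_ofSubtype β τ j x).1 h), fun y hy => ?_⟩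
    have hyb := sameCycle_mem (ofSubtype_mem_permsOn β τ) x.2 hy
    exact h2 ⟨y, hyb⟩ ((sameCycle_ofSubtype β τ x ⟨y, hyb⟩).1 hy)
  · rintro ⟨hx, h1, h2⟩
    refine ⟨⟨x, hx⟩, ⟨fun h => h1 ((sameCycle_ofSubtype β τ j ⟨x, hx⟩).2 h), fun y hy => ?_⟩, rfl⟩
    exact h2 y ((sameCycle_ofSubtype β τ ⟨x, hx⟩ y).2 hy)

/-- Extending permutations of `β` by the identity keeps signs, cycles and the order of their least
elements. Subsets can then vary without a change of index type. -/
theorem cdet_principalSubmatrix (β : Finset ι) (A : Matrix ι ι R) (j : β) :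
    cdet (principalSubmatrix A β) j = cdetOn β A j := by
  unfold cdet cdetOn
  refine Finset.sum_bij' (fun τ _ => Equiv.Perm.ofSubtype τ)
    (fun τ hτ => ((Equiv.Perm.subtypeEquivSubtypePerm (· ∈ β)).symm ⟨τ, mem_permsOn.1 hτ⟩))
    (fun τ _ => ofSubtype_mem_permsOn β τ) (fun _ _ => Finset.mem_univ _)
    (fun τ _ => ?_) (fun τ hτ => ?_) (fun τ _ => ?_)
  · exact (Equiv.Perm.subtypeEquivSubtypePerm (· ∈ β)).symm_apply_apply τ
  · exact congrArg Subtype.val ((Equiv.Perm.subtypeEquivSubtypePerm (· ∈ β)).apply_symm_apply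
      ⟨τ, mem_permsOn.1 hτ⟩)
  · rw [Equiv.Perm.sign_ofSubtype, headsProd, ← otherCycleHeads_map, colCycleProd_ofSubtype,
      ← List.map_reverse, List.map_map]
    congr 5
    funext x
    exact colCycleProd_ofSubtype β A τ x

/-- The least element of `β` opens its own cycle and is the smallest opener, so its monomial already
stands rightmost. -/
theorem detOn_eq_cdetOn_min' {β : Finset ι} (h : β.Nonempty) (A : Matrix ι ι R) :
    detOn β A = cdetOn β A (β.min' h) := by
  unfold detOn cdetOn
  refine Finset.sum_congr rfl fun τ hτ => ?_
  congr 1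
  have hins : (β.filter fun x => ∀ y, τ.SameCycle x y → x ≤ y) =
      insert (β.min' h) (cycleHeadsOn β τ (β.min' h)) := by
    ext x
    simp only [Finset.mem_filter, Finset.mem_insert, cycleHeadsOn]
    constructor
    · rintro ⟨hx, h2⟩
      by_cases hs : τ.SameCycle (β.min' h) x
      · exact Or.inl (le_antisymm (h2 _ hs.symm) (β.min'_le _ hx))
      · exact Or.inr ⟨hx, hs, h2⟩
    · rintro (rfl | ⟨hx, -, h2⟩)
      · exact ⟨β.min'_mem h, fun y hy =>
          β.min'_le _ (sameCycle_mem hτ (β.min'_mem h) hy)⟩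
      · exact ⟨hx, h2⟩
  rw [hins, headsProd, Finset.sort_insert]
  · simp [headsProd]
  · intro b hb
    exact β.min'_le _ (Finset.mem_filter.1 hb).1
  · intro hb
    exact (Finset.mem_filter.1 hb).2.1 (Equiv.Perm.SameCycle.refl _ _)

theorem permsOn_empty : permsOn (∅ : Finset ι) = {1} := by
  ext τ
  simp [mem_permsOn, Equiv.Perm.ext_iff]

theorem detOn_empty (A : Matrix ι ι R) : detOn ∅ A = 1 := by
  simp [detOn, permsOn_empty, headsProd]

theorem hermDet_principalSubmatrix (β : Finset ι) (A : Matrix ι ι ℍ[ℝ]) :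
    hermDet (principalSubmatrix A β) = detOn β A := by
  unfold hermDet
  split_ifs with h
  · have hβ : β.Nonempty := by
      obtain ⟨x, -⟩ := h
      exact ⟨x, x.2⟩
    rw [cdet_principalSubmatrix, detOn_eq_cdetOn_min' hβ]
    congr 1
    refine le_antisymm ?_ (β.min'_le _ (Subtype.prop _))
    exact Finset.min'_le Finset.univ (⟨β.min' hβ, β.min'_mem hβ⟩ : β) (Finset.mem_univ _)
  · have : β = ∅ := by
      by_contra hβ
      obtain ⟨x, hx⟩ := Finset.nonempty_iff_ne_empty.2 hβ
      exact h ⟨⟨x, hx⟩, Finset.mem_univ _⟩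
    subst this
    rw [detOn_empty]

theorem hermDet_eq_detOn_univ (A : Matrix ι ι ℍ[ℝ]) : hermDet A = detOn Finset.univ A := by
  unfold hermDet
  split_ifs with h
  · rw [cdet_eq_cdetOn_univ, detOn_eq_cdetOn_min' h]
  · rw [Finset.not_nonempty_iff_eq_empty.1 h, detOn_empty]

/-- The part of the monomial of `τ` in `cdetOn β A j` that does not involve column `j`. -/
def cofactorMonomial (β : Finset ι) (A : Matrix ι ι R) (τ : Equiv.Perm ι) (j : ι) : R :=
  ((Equiv.Perm.sign τ : ℤ) : R) *
    (headsProd A τ (cycleHeadsOn β τ j) * pathProd A τ (cycleLength τ j - 1) (τ j))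

theorem headsProd_updateCol (β : Finset ι) (A : Matrix ι ι R) (τ : Equiv.Perm ι) (j : ι)
    (v : ι → R) : headsProd (A.updateCol j v) τ (cycleHeadsOn β τ j) =
      headsProd A τ (cycleHeadsOn β τ j) := by
  refine headsProd_congr fun x hx => pathProd_congr fun t _ => ?_
  rw [Matrix.updateCol_ne]
  rintro rfl
  exact (Finset.mem_filter.1 hx).2.1
    ((Equiv.Perm.sameCycle_pow_left).2 (Equiv.Perm.SameCycle.refl _ _))

theorem colCycleProd_updateCol (A : Matrix ι ι R) (τ : Equiv.Perm ι) (j : ι) (v : ι → R) :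
    colCycleProd (A.updateCol j v) τ j =
      pathProd A τ (cycleLength τ j - 1) (τ j) * v (τ j) := by
  obtain ⟨k, hk⟩ := Nat.exists_eq_succ_of_ne_zero (cycleLength_pos τ j).ne'
  rw [colCycleProd_eq_pathProd, hk, pathProd_succ, Matrix.updateCol_self]
  congr 1
  refine pathProd_congr fun t ht => ?_
  rw [Matrix.updateCol_ne]
  have : (τ ^ t) (τ j) = (τ ^ (t + 1)) j := by rw [pow_succ, Equiv.Perm.mul_apply]
  rw [this]
  exact pow_apply_ne_self τ j (Nat.succ_pos t) (by omega)

theorem cdetOn_updateCol (β : Finset ι) (A : Matrix ι ι R) (j : ι) (v : ι → R) :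
    cdetOn β (A.updateCol j v) j = ∑ τ ∈ permsOn β, cofactorMonomial β A τ j * v (τ j) := by
  unfold cdetOn
  refine Finset.sum_congr rfl fun τ _ => ?_
  rw [headsProd_updateCol, colCycleProd_updateCol, cofactorMonomial]
  simp only [mul_assoc]

/-- The `(l, j)` cofactor of the principal submatrix on `β`. -/
def cofactorOn (β : Finset ι) (A : Matrix ι ι R) (j l : ι) : R :=
  cdetOn β (A.updateCol j (Pi.single l 1)) j

/-- Each monomial meets column `j` once, in its rightmost factor; grouping by the row `τ j` of that
factor gives the expansion. -/
theorem cdetOn_updateCol_eq_sum {β : Finset ι} (A : Matrix ι ι R) {j : ι} (hj : j ∈ β)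
    (v : ι → R) : cdetOn β (A.updateCol j v) j = ∑ l ∈ β, cofactorOn β A j l * v l := by
  simp only [cofactorOn, cdetOn_updateCol, Finset.sum_mul]
  rw [Finset.sum_comm]
  refine Finset.sum_congr rfl fun τ hτ => ?_
  rw [Finset.sum_eq_single (τ j)]
  · simp
  · intro l _ hl
    simp [hl.symm]
  · intro h
    exact absurd (apply_mem_of_mem_permsOn hτ hj) h

theorem cofactorOn_eq_sum (β : Finset ι) (A : Matrix ι ι R) (j l : ι) :
    cofactorOn β A j l = ∑ τ ∈ (permsOn β).filter fun τ => τ j = l, cofactorMonomial β A τ j := by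
  rw [cofactorOn, cdetOn_updateCol, Finset.sum_filter]
  refine Finset.sum_congr rfl fun τ _ => ?_
  by_cases h : τ j = l <;> simp [h]

/-- Only permutations fixing `j` contribute, and for them the path left from the cycle of `j` is
empty. -/
theorem cofactorOn_self {β : Finset ι} (A : Matrix ι ι R) {j : ι} :
    cofactorOn β A j j = detOn (β.erase j) A := by
  rw [cofactorOn_eq_sum, detOn]
  have hset : ((permsOn β).filter fun τ => τ j = j) = permsOn (β.erase j) := by
    ext τ
    simp only [Finset.mem_filter, mem_permsOn, Finset.mem_erase, not_and_or, not_not]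
    constructor
    · rintro ⟨h1, h2⟩ x (rfl | hx)
      · exact h2
      · exact h1 x hx
    · intro h
      exact ⟨fun x hx => h x (Or.inr hx), h j (Or.inl rfl)⟩
  rw [hset]
  refine Finset.sum_congr rfl fun τ hτ => ?_
  have hj : τ j = j := mem_permsOn.1 hτ j (by simp)
  have hs : ∀ x, τ.SameCycle j x ↔ j = x := fun x =>
    ⟨fun h => h.eq_of_left hj, fun h => h ▸ Equiv.Perm.SameCycle.refl _ _⟩
  have hl : cycleLength τ j = 1 := by
    simp only [cycleLength, hs]
    rw [Finset.card_eq_one]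
    exact ⟨j, by ext x; simp [eq_comm]⟩
  rw [cofactorMonomial, hl]
  have h1 : pathProd A τ (1 - 1) (τ j) = 1 := rfl
  rw [h1, mul_one]
  congr 2
  ext x
  simp only [cycleHeadsOn, hs, Finset.mem_filter, Finset.mem_erase, ne_comm (a := j)]
  tauto

/-! ### Removing an index from a cycle. -/

section Contract

variable {τ τ' : Equiv.Perm ι} {i l : ι}

/-- In `τ` the index `l` directly follows `i`, so the `τ`-path from `l` follows the `τ'`-path from
`i` until that returns to `i`. The starting points differ, hence `0 < t`. -/
theorem contract_pow_apply (hil : i ≠ l) (h : τ' = τ * Equiv.swap i l)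
    (hl : τ i = l) {t : ℕ} (ht : 0 < t) (ht' : t ≤ cycleLength τ' i) :
    (τ ^ t) l = (τ' ^ t) i := by
  have hl' : τ' l = l := by rw [h]; simp [hl]
  induction t, ht using Nat.le_induction with
  | base => simp [h]
  | succ t ht ih =>
    rw [pow_succ', pow_succ', Equiv.Perm.mul_apply, Equiv.Perm.mul_apply, ih (by omega)]
    apply contract_apply h
    · exact pow_apply_ne_self τ' i ht (by omega)
    · intro hc
      have : τ'.SameCycle l i := hc ▸ Equiv.Perm.sameCycle_pow_left.2
        (Equiv.Perm.SameCycle.refl _ _)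
      exact hil (this.eq_of_left hl').symm

theorem contract_sameCycle_of_not (h : τ' = τ * Equiv.swap i l)
    (hl : τ i = l) {x : ι} (hx : ¬ τ'.SameCycle i x) (hxl : x ≠ l) (y : ι) :
    τ.SameCycle x y ↔ τ'.SameCycle x y := by
  constructor
  · intro hs
    obtain ⟨t, ht⟩ := hs.exists_nat_pow_eq
    rw [contract_pow_apply_of_not_sameCycle h hl hx hxl] at ht
    exact ⟨t, by simpa using ht⟩
  · intro hs
    obtain ⟨t, ht⟩ := hs.exists_nat_pow_eq
    rw [← contract_pow_apply_of_not_sameCycle h hl hx hxl] at ht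
    exact ⟨t, by simpa using ht⟩

theorem contract_sameCycle_iff (hil : i ≠ l) (h : τ' = τ * Equiv.swap i l)
    (hl : τ i = l) (y : ι) : τ.SameCycle i y ↔ y = l ∨ τ'.SameCycle i y := by
  constructor
  · intro hs
    by_contra! hc
    exact hc.2 ((contract_sameCycle_of_not h hl hc.2 hc.1 i).1 hs.symm).symm
  · have hil' : τ.SameCycle i l := ⟨1, by simpa using hl⟩
    rintro (rfl | hs)
    · exact hil'
    · have hp := cycleLength_pos τ' i
      obtain ⟨t, ht⟩ := hs.exists_nat_pow_eq
      rcases Nat.eq_zero_or_pos (t % cycleLength τ' i) with h0 | h0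
      · have : (τ' ^ t) i = i := by
          rw [← Nat.div_add_mod t (cycleLength τ' i), h0, add_zero, pow_mul]
          exact Equiv.Perm.pow_apply_eq_self_of_apply_eq_self (pow_cycleLength_apply τ' i) _
        rw [← ht, this]
      · have h1 : (τ' ^ (t % cycleLength τ' i)) i = y := by
          rw [← ht]
          conv_rhs => rw [← Nat.mod_add_div t (cycleLength τ' i), pow_add, pow_mul,
            Equiv.Perm.mul_apply,
            Equiv.Perm.pow_apply_eq_self_of_apply_eq_self (pow_cycleLength_apply τ' i)]
        rw [← contract_pow_apply hil h hl h0 (Nat.mod_lt _ hp).le] at h1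
        exact hil'.trans (h1 ▸ Equiv.Perm.sameCycle_pow_right.2 (Equiv.Perm.SameCycle.refl _ _))

theorem contract_cycleLength (hil : i ≠ l) (h : τ' = τ * Equiv.swap i l)
    (hl : τ i = l) : cycleLength τ i = cycleLength τ' i + 1 := by
  have hl' : τ' l = l := by rw [h]; simp [hl]
  simp only [cycleLength, contract_sameCycle_iff hil h hl]
  rw [← Finset.card_insert_of_notMem (a := l)]
  · congr 1
    ext y
    simp
  · intro hc
    exact hil ((Finset.mem_filter.1 hc).2.eq_of_right hl')

/-- The path left after deleting the factor in column `i` starts at `l`. Read in `τ'`, it is the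
whole cycle of `i`, its first step taken from column `l` instead of column `i`. The transposition
accounts for the sign. -/
theorem cofactorMonomial_contract {β : Finset ι} (A : Matrix ι ι R) (hil : i ≠ l)
    (h : τ' = τ * Equiv.swap i l) (hl : τ i = l) :
    cofactorMonomial β A τ i = -(((Equiv.Perm.sign τ' : ℤ) : R) *
      (headsProd (A.updateCol i (fun k => A k l)) τ' (cycleHeadsOn (β.erase l) τ' i) *
        colCycleProd (A.updateCol i (fun k => A k l)) τ' i)) := by
  have hl' : τ' l = l := by rw [h]; simp [hl]
  have hsign : ((Equiv.Perm.sign τ' : ℤ) : R) = -((Equiv.Perm.sign τ : ℤ) : R) := by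
    rw [h, Equiv.Perm.sign_mul, Equiv.Perm.sign_swap hil]
    simp
  have hheads : cycleHeadsOn β τ i = cycleHeadsOn (β.erase l) τ' i := by
    ext x
    simp only [cycleHeadsOn, Finset.mem_filter, Finset.mem_erase, contract_sameCycle_iff hil h hl,
      not_or]
    constructor
    · rintro ⟨h1, ⟨h2, h3⟩, h4⟩
      exact ⟨⟨h2, h1⟩, h3, fun y hy => h4 y ((contract_sameCycle_of_not h hl h3 h2 y).2 hy)⟩
    · rintro ⟨⟨h2, h1⟩, h3, h4⟩
      exact ⟨h1, ⟨h2, h3⟩, fun y hy => h4 y ((contract_sameCycle_of_not h hl h3 h2 y).1 hy)⟩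
  have hcol : pathProd A τ (cycleLength τ i - 1) (τ i) =
      colCycleProd (A.updateCol i (fun k => A k l)) τ' i := by
    rw [contract_cycleLength hil h hl, Nat.add_sub_cancel, hl, colCycleProd_eq_pathProd]
    refine pathProd_congr fun t ht => ?_
    rw [contract_pow_apply hil h hl (Nat.succ_pos t) ht]
    rcases Nat.eq_zero_or_pos t with rfl | h0
    · simp
    · rw [contract_pow_apply hil h hl h0 ht.le, Matrix.updateCol_ne (pow_apply_ne_self τ' i h0 ht)]
  have hprod : headsProd A τ (cycleHeadsOn (β.erase l) τ' i) =
      headsProd A τ' (cycleHeadsOn (β.erase l) τ' i) := by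
    refine headsProd_congr fun x hx => ?_
    obtain ⟨hxβ, hx, -⟩ := Finset.mem_filter.1 hx
    have hxl := (Finset.mem_erase.1 hxβ).1
    have hlen : cycleLength τ x = cycleLength τ' x := by
      simp only [cycleLength, contract_sameCycle_of_not h hl hx hxl]
    rw [colCycleProd_eq_pathProd, colCycleProd_eq_pathProd, hlen]
    refine pathProd_congr fun t _ => ?_
    simp only [contract_pow_apply_of_not_sameCycle h hl hx hxl]
  rw [cofactorMonomial, hcol, hheads, hprod, hsign, headsProd_updateCol, neg_mul, neg_neg]

end Contract

theorem cofactorOn_of_ne {β : Finset ι} (A : Matrix ι ι R) {i l : ι} (hi : i ∈ β) (hl : l ∈ β)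
    (hil : i ≠ l) :
    cofactorOn β A i l = -cdetOn (β.erase l) (A.updateCol i (fun k => A k l)) i := by
  rw [cofactorOn_eq_sum, cdetOn, ← Finset.sum_neg_distrib]
  refine Finset.sum_bij' (fun τ _ => τ * Equiv.swap i l) (fun τ _ => τ * Equiv.swap i l)
    (fun τ hτ => ?_) (fun τ hτ => ?_) (fun τ _ => ?_) (fun τ _ => ?_) (fun τ hτ => ?_)
  · obtain ⟨h1, h2⟩ := Finset.mem_filter.1 hτ
    rw [mem_permsOn] at h1 ⊢
    intro x hx
    rw [Finset.mem_erase, not_and_or, not_not] at hx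
    rw [Equiv.Perm.mul_apply]
    by_cases hxl : x = l
    · rw [hxl, Equiv.swap_apply_right, h2]
    · have hx := hx.resolve_left hxl
      rw [Equiv.swap_apply_of_ne_of_ne (by rintro rfl; exact hx hi) hxl, h1 x hx]
  · rw [Finset.mem_filter]
    rw [mem_permsOn] at hτ ⊢
    constructor
    · intro x hx
      rw [Equiv.Perm.mul_apply, Equiv.swap_apply_of_ne_of_ne (by rintro rfl; exact hx hi)
        (by rintro rfl; exact hx hl)]
      exact hτ x (by simp [hx])
    · rw [Equiv.Perm.mul_apply, Equiv.swap_apply_left]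
      exact hτ l (by simp)
  · simp
  · simp
  · exact cofactorMonomial_contract A hil rfl (Finset.mem_filter.1 hτ).2

end ColumnDeterminant

/-! ### Cramer's rule for positive definite Hermitian matrices. -/

section QuaternionHermitian

variable {ι : Type*}

theorem Quaternion.eq_coe_re_of_star_eq {a : ℍ[ℝ]} (h : star a = a) : a = ((a.re : ℝ) : ℍ[ℝ]) :=
  Quaternion.star_eq_self.1 h

theorem Matrix.IsHermitian.star_dotProduct_mulVec [Fintype ι] {H : Matrix ι ι ℍ[ℝ]}
    (hH : H.IsHermitian) (x y : ι → ℍ[ℝ]) :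
    star x ⬝ᵥ (H *ᵥ y) = star (star y ⬝ᵥ (H *ᵥ x)) := by
  rw [Matrix.star_dotProduct, Matrix.dotProduct_mulVec (star y), Matrix.star_mulVec, hH.eq]

/-- Left multiplication by a quaternion matrix, as a real linear map. -/
def Matrix.mulVecReal {κ : Type*} [Fintype ι] (M : Matrix κ ι ℍ[ℝ]) :
    (ι → ℍ[ℝ]) →ₗ[ℝ] (κ → ℍ[ℝ]) where
  toFun x := M *ᵥ x
  map_add' := M.mulVec_add
  map_smul' c x := M.mulVec_smul c x

theorem Matrix.mulVec_mul_right {κ : Type*} [Fintype ι] (M : Matrix κ ι ℍ[ℝ]) (x : ι → ℍ[ℝ])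
    (a : ℍ[ℝ]) (p : κ) : (M *ᵥ fun q => x q * a) p = (M *ᵥ x) p * a := by
  simp only [Matrix.mulVec, dotProduct, Finset.sum_mul, mul_assoc]

variable [Fintype ι]

/-- The Hermitian form of `H` is positive definite on the vectors supported on `β`. -/
def PosDefOn (β : Finset ι) (H : Matrix ι ι ℍ[ℝ]) : Prop :=
  ∀ x : ι → ℍ[ℝ], (∀ p, p ∉ β → x p = 0) → x ≠ 0 → 0 < (star x ⬝ᵥ (H *ᵥ x)).re

theorem PosDefOn.mono {β γ : Finset ι} {H : Matrix ι ι ℍ[ℝ]} (h : PosDefOn β H) (hγ : γ ⊆ β) :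
    PosDefOn γ H :=
  fun x hx hx0 => h x (fun p hp => hx p fun hp' => hp (hγ hp')) hx0

theorem star_dotProduct_eq_sum {β : Finset ι} {x y v : ι → ℍ[ℝ]} (hx : ∀ p, p ∉ β → x p = 0)
    (hv : ∀ p ∈ β, y p = v p) : star x ⬝ᵥ y = ∑ p ∈ β, star (x p) * v p := by
  rw [dotProduct, ← Finset.sum_subset (Finset.subset_univ β)]
  · exact Finset.sum_congr rfl fun p hp => by rw [hv p hp]; rfl
  · intro p _ hp
    simp [hx p hp]

variable [LinearOrder ι]

theorem PosDefOn.exists_mulVec_eq {β : Finset ι} {H : Matrix ι ι ℍ[ℝ]} (h : PosDefOn β H)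
    (v : ι → ℍ[ℝ]) : ∃ u : ι → ℍ[ℝ], (∀ p, p ∉ β → u p = 0) ∧ ∀ p ∈ β, (H *ᵥ u) p = v p := by
  -- `K` is the block of `H` on `β` completed by the identity: positive definiteness makes it
  -- injective, hence surjective by real dimension.
  let K : Matrix ι ι ℍ[ℝ] := fun p q =>
    if p ∈ β then (if q ∈ β then H p q else 0) else (if p = q then 1 else 0)
  have hKn : ∀ x p, p ∉ β → (K *ᵥ x) p = x p := by
    intro x p hp
    simp [K, Matrix.mulVec, dotProduct, hp]
  have hKm : ∀ x : ι → ℍ[ℝ], (∀ p, p ∉ β → x p = 0) → ∀ p ∈ β, (K *ᵥ x) p = (H *ᵥ x) p := by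
    intro x hx p hp
    simp only [K, Matrix.mulVec, dotProduct, hp, if_true]
    refine Finset.sum_congr rfl fun q _ => ?_
    by_cases hq : q ∈ β
    · simp [hq]
    · simp [hq, hx q hq]
  have hinj : Function.Injective (Matrix.mulVecReal K) := by
    rw [← LinearMap.ker_eq_bot, LinearMap.ker_eq_bot']
    intro x hx
    have hx' : K *ᵥ x = 0 := hx
    have hx0 : ∀ p, p ∉ β → x p = 0 := fun p hp => by rw [← hKn x p hp, hx']; rfl
    by_contra hne
    have hpos := h x hx0 hne
    rw [star_dotProduct_eq_sum (v := 0) hx0 fun p hp => by rw [← hKm x hx0 p hp, hx']] at hpos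
    simp at hpos
  obtain ⟨u, hu⟩ := LinearMap.injective_iff_surjective.1 hinj fun p => if p ∈ β then v p else 0
  have hu' : K *ᵥ u = fun p => if p ∈ β then v p else 0 := hu
  have hu0 : ∀ p, p ∉ β → u p = 0 := fun p hp => by rw [← hKn u p hp, hu']; simp [hp]
  exact ⟨u, hu0, fun p hp => by rw [← hKm u hu0 p hp, hu']; simp [hp]⟩

/-- By induction on `β`, the cofactors are one real multiple of the entries of the inverse of the
block on `β`; the multiple is $d$. -/
theorem PosDefOn.exists_det {H : Matrix ι ι ℍ[ℝ]} (hH : H.IsHermitian) (β : Finset ι)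
    (hβ : PosDefOn β H) : ∃ d : ℝ, 0 < d ∧ detOn β H = (d : ℍ[ℝ]) ∧
      ∀ i ∈ β, ∀ x v : ι → ℍ[ℝ], (∀ p, p ∉ β → x p = 0) → (∀ p ∈ β, v p = (H *ᵥ x) p) →
        cdetOn β (H.updateCol i v) i = (d : ℍ[ℝ]) * x i := by
  induction β using Finset.strongInduction with
  | H β ih =>
  rcases β.eq_empty_or_nonempty with rfl | hne
  · exact ⟨1, one_pos, by simp [detOn_empty], by simp⟩
  -- `u l` is column `l` of the inverse of the block, extended by zero; `N l` below is its diagonal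
  -- entry.
  choose u hu0 hu using fun l => hβ.exists_mulVec_eq (Pi.single l 1)
  have hform : ∀ l ∈ β, ∀ x : ι → ℍ[ℝ], (∀ p, p ∉ β → x p = 0) →
      star x ⬝ᵥ (H *ᵥ u l) = star (x l) := by
    intro l hl x hx
    rw [star_dotProduct_eq_sum hx (hu l), Finset.sum_eq_single l]
    · simp
    · intro p _ hp
      simp [hp]
    · exact fun h => absurd hl h
  have hsymm : ∀ k ∈ β, ∀ l ∈ β, u l k = star (u k l) := by
    intro k hk l hl
    rw [← hform l hl (u k) (hu0 k), hH.star_dotProduct_mulVec, hform k hk (u l) (hu0 l), star_star]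
  obtain ⟨N, hN⟩ : ∃ N : ι → ℝ, ∀ l, N l = (u l l).re := ⟨_, fun _ => rfl⟩
  have hNeq : ∀ l ∈ β, u l l = (N l : ℍ[ℝ]) := fun l hl => by
    rw [hN]
    exact Quaternion.eq_coe_re_of_star_eq (hsymm l hl l hl).symm
  have hNpos : ∀ l ∈ β, 0 < N l := by
    intro l hl
    have := hβ (u l) (hu0 l) fun h => by
      have := hu l l hl
      simp [h] at this
    rwa [hform l hl (u l) (hu0 l), Quaternion.re_star, ← hN] at this
  have ih' : ∀ l, ∃ d : ℝ, l ∈ β → (0 < d ∧ detOn (β.erase l) H = (d : ℍ[ℝ]) ∧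
      ∀ i ∈ β.erase l, ∀ x v : ι → ℍ[ℝ], (∀ p, p ∉ β.erase l → x p = 0) →
        (∀ p ∈ β.erase l, v p = (H *ᵥ x) p) →
        cdetOn (β.erase l) (H.updateCol i v) i = (d : ℍ[ℝ]) * x i) := by
    intro l
    by_cases hl : l ∈ β
    · obtain ⟨d, hd⟩ := ih _ (Finset.erase_ssubset hl) (hβ.mono (Finset.erase_subset _ _))
      exact ⟨d, fun _ => hd⟩
    · exact ⟨0, fun h => absurd h hl⟩
  choose d hd using ih'
  have hcof : ∀ i ∈ β, ∀ l ∈ β, cofactorOn β H i l = ((d l / N l : ℝ) : ℍ[ℝ]) * u l i := by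
    intro i hi l hl
    have hNl := (hNpos l hl).ne'
    by_cases hil : i = l
    · subst hil
      rw [cofactorOn_self, (hd i hi).2.1, hNeq i hi, ← Quaternion.coe_mul, div_mul_cancel₀ _ hNl]
    -- On `β.erase l`, column `l` of `H` equals `H` applied to $e_l-N_l^{-1}u_l$, whose entry at `l`
    -- vanishes, so induction evaluates the smaller determinant.
    · rw [cofactorOn_of_ne H hi hl hil,
        (hd l hl).2.2 i (Finset.mem_erase.2 ⟨hil, hi⟩) (Pi.single l 1 - (N l)⁻¹ • u l)]
      · rw [Pi.sub_apply, Pi.smul_apply, Pi.single_eq_of_ne hil, zero_sub, mul_neg, neg_neg,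
          Quaternion.coe_mul_eq_smul, smul_smul, Quaternion.coe_mul_eq_smul, div_eq_mul_inv]
      · intro p hp
        by_cases hpl : p = l
        · subst hpl
          rw [Pi.sub_apply, Pi.smul_apply, hNeq p hl, Pi.single_eq_same,
            ← Quaternion.coe_mul_eq_smul, ← Quaternion.coe_mul, inv_mul_cancel₀ hNl]
          simp
        · rw [Pi.sub_apply, Pi.smul_apply, hu0 l p fun h => hp (Finset.mem_erase.2 ⟨hpl, h⟩)]
          simp [hpl]
      · intro p hp
        obtain ⟨hpl, hp⟩ := Finset.mem_erase.1 hp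
        rw [Matrix.mulVec_sub, Matrix.mulVec_smul, Pi.sub_apply, Pi.smul_apply, hu l p hp]
        simp [hpl]
  -- Eliminating the entry at `l` from `u k`, with the scalar on the right, gives column `k` of the
  -- inverse of the block on `β.erase l`.
  have hcomp : ∀ k ∈ β, ∀ l ∈ β, k ≠ l → detOn ((β.erase l).erase k) H =
      ((d l * (N k - (N l)⁻¹ * Quaternion.normSq (u k l)) : ℝ) : ℍ[ℝ]) := by
    intro k hk l hl hkl
    have hNl := (hNpos l hl).ne'
    rw [← cofactorOn_self, cofactorOn, (hd l hl).2.2 k (Finset.mem_erase.2 ⟨hkl, hk⟩)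
      (u k - fun p => u l p * ((N l)⁻¹ • u k l))]
    · rw [Pi.sub_apply, hNeq k hk, hsymm k hk l hl, mul_smul_comm, Quaternion.star_mul_self,
        ← Quaternion.coe_mul_eq_smul]
      push_cast
      rfl
    · intro p hp
      by_cases hpl : p = l
      · subst hpl
        rw [Pi.sub_apply, hNeq p hl, mul_smul_comm, Quaternion.coe_mul_eq_smul, smul_smul,
          inv_mul_cancel₀ hNl, one_smul, sub_self]
      · have hp' : p ∉ β := fun h => hp (Finset.mem_erase.2 ⟨hpl, h⟩)
        simp [hu0 _ p hp']
    · intro p hp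
      obtain ⟨hpl, hp⟩ := Finset.mem_erase.1 hp
      rw [Matrix.mulVec_sub, Pi.sub_apply, Matrix.mulVec_mul_right, hu k p hp, hu l p hp]
      simp [hpl]
  -- The determinant without `k` and `l` can be computed by removing either one first. Both values
  -- carry the factor $N_kN_l-|u_{kl}|^2$, nonzero since this determinant is positive.
  have hconst : ∀ k ∈ β, ∀ l ∈ β, d k / N k = d l / N l := by
    intro k hk l hl
    by_cases hkl : k = l
    · rw [hkl]
    have h1 := hcomp k hk l hl hkl
    have h2 := hcomp l hl k hk (Ne.symm hkl)
    obtain ⟨e, he, he', -⟩ := ih ((β.erase l).erase k)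
      ((Finset.erase_subset _ _).trans_ssubset (Finset.erase_ssubset hl))
      (hβ.mono ((Finset.erase_subset _ _).trans (Finset.erase_subset _ _)))
    have hns : Quaternion.normSq (u l k) = Quaternion.normSq (u k l) := by
      rw [hsymm k hk l hl, Quaternion.normSq_star]
    rw [Finset.erase_right_comm, hns] at h2
    rw [h1] at he' h2
    rw [Quaternion.coe_inj] at he' h2
    have hNl := (hNpos l hl).ne'
    have hNk := (hNpos k hk).ne'
    obtain ⟨s, hs⟩ : ∃ s, s = Quaternion.normSq (u k l) := ⟨_, rfl⟩
    rw [← hs] at he' h2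
    have e1 : d l * (N k - (N l)⁻¹ * s) = d l / N l * (N k * N l - s) := by field_simp
    have e2 : d k * (N l - (N k)⁻¹ * s) = d k / N k * (N k * N l - s) := by field_simp
    rw [e1] at he' h2
    rw [e2] at h2
    have hne0 : N k * N l - s ≠ 0 := by
      intro h0
      rw [h0, mul_zero] at he'
      exact he.ne he'
    exact (mul_right_cancel₀ hne0 h2).symm
  obtain ⟨l₀, hl₀⟩ := hne
  have hmain : ∀ i ∈ β, ∀ x v : ι → ℍ[ℝ], (∀ p, p ∉ β → x p = 0) →
      (∀ p ∈ β, v p = (H *ᵥ x) p) →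
        cdetOn β (H.updateCol i v) i = ((d l₀ / N l₀ : ℝ) : ℍ[ℝ]) * x i := by
    intro i hi x v hx hv
    rw [cdetOn_updateCol_eq_sum H hi]
    have : ∀ l ∈ β, cofactorOn β H i l * v l =
        ((d l₀ / N l₀ : ℝ) : ℍ[ℝ]) * (star (u i l) * v l) := by
      intro l hl
      rw [hcof i hi l hl, hsymm i hi l hl, hconst l hl l₀ hl₀, mul_assoc]
    rw [Finset.sum_congr rfl this, ← Finset.mul_sum,
      ← star_dotProduct_eq_sum (hu0 i) fun p hp => (hv p hp).symm, hH.star_dotProduct_mulVec,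
      hform i hi x hx, star_star]
  refine ⟨d l₀ / N l₀, div_pos (hd l₀ hl₀).1 (hNpos l₀ hl₀), ?_, hmain⟩
  have hm := β.min'_mem ⟨l₀, hl₀⟩
  rw [detOn_eq_cdetOn_min' ⟨l₀, hl₀⟩]
  have := hmain _ hm (Pi.single (β.min' ⟨l₀, hl₀⟩) 1) (fun k => H k (β.min' ⟨l₀, hl₀⟩))
    (fun p hp => by
      rw [Pi.single_apply, if_neg]
      rintro rfl
      exact hp hm)
    (fun p _ => by simp)
  rw [Matrix.updateCol_eq_self] at this
  rw [this]
  simp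

end QuaternionHermitian

/-! ### Gram matrices and the rank-deficient Cramer rule. -/

section Gram

theorem continuous_cdetOn {ι T : Type*} [Fintype ι] [LinearOrder ι] [TopologicalSpace T]
    {M : T → Matrix ι ι ℍ[ℝ]} (hM : ∀ p q, Continuous fun t => M t p q) (β : Finset ι) (j : ι) :
    Continuous fun t => cdetOn β (M t) j := by
  have hcol : ∀ τ x, Continuous fun t => colCycleProd (M t) τ x := fun τ x =>
    continuous_list_prod _ fun k _ => hM _ _
  unfold cdetOn
  refine continuous_finsetSum _ fun τ _ => continuous_const.mul (Continuous.mul ?_ (hcol τ j))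
  exact continuous_list_prod _ fun k _ => hcol τ k

theorem continuous_detOn {ι T : Type*} [Fintype ι] [LinearOrder ι] [TopologicalSpace T]
    {M : T → Matrix ι ι ℍ[ℝ]} (hM : ∀ p q, Continuous fun t => M t p q) (β : Finset ι) :
    Continuous fun t => detOn β (M t) := by
  rcases β.eq_empty_or_nonempty with rfl | h
  · simpa only [detOn_empty] using continuous_const
  · simpa only [detOn_eq_cdetOn_min' h] using continuous_cdetOn hM β _

theorem Quaternion.re_sum {α : Type*} (s : Finset α) (f : α → ℍ[ℝ]) :
    (∑ p ∈ s, f p).re = ∑ p ∈ s, (f p).re := by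
  classical
  induction s using Finset.induction_on with
  | empty => rfl
  | insert a s ha ih => rw [Finset.sum_insert ha, Finset.sum_insert ha, Quaternion.re_add, ih]

theorem re_star_dotProduct_self {ι : Type*} [Fintype ι] (x : ι → ℍ[ℝ]) :
    (star x ⬝ᵥ x).re = ∑ p, Quaternion.normSq (x p) := by
  simp only [dotProduct, Pi.star_apply, Quaternion.star_mul_self, Quaternion.re_sum,
    Quaternion.re_coe]

theorem re_star_dotProduct_self_nonneg {ι : Type*} [Fintype ι] (x : ι → ℍ[ℝ]) :
    0 ≤ (star x ⬝ᵥ x).re := by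
  rw [re_star_dotProduct_self]
  exact Finset.sum_nonneg fun _ _ => Quaternion.normSq_nonneg

theorem re_star_dotProduct_self_eq_zero {ι : Type*} [Fintype ι] {x : ι → ℍ[ℝ]}
    (h : (star x ⬝ᵥ x).re = 0) : x = 0 := by
  rw [re_star_dotProduct_self,
    Finset.sum_eq_zero_iff_of_nonneg fun _ _ => Quaternion.normSq_nonneg] at h
  ext1 p
  exact Quaternion.normSq_eq_zero.1 (h p (Finset.mem_univ p))

variable {κ ι : Type*} [Fintype κ] [Fintype ι]

theorem star_dotProduct_gram_mulVec (A : Matrix κ ι ℍ[ℝ]) (x : ι → ℍ[ℝ]) :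
    star x ⬝ᵥ ((Aᴴ * A) *ᵥ x) = star (A *ᵥ x) ⬝ᵥ (A *ᵥ x) := by
  rw [← Matrix.mulVec_mulVec, Matrix.dotProduct_mulVec, Matrix.star_mulVec]

theorem mulVec_eq_zero_of_gram_mulVec_eq_zero {A : Matrix κ ι ℍ[ℝ]} {x : ι → ℍ[ℝ]}
    (h : (Aᴴ * A) *ᵥ x = 0) : A *ᵥ x = 0 := by
  apply re_star_dotProduct_self_eq_zero
  rw [← star_dotProduct_gram_mulVec, h, dotProduct_zero, Quaternion.re_zero]

theorem finrank_range_mulVecReal_gram (A : Matrix κ ι ℍ[ℝ]) :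
    Module.finrank ℝ (Matrix.mulVecReal (Aᴴ * A)).range =
      Module.finrank ℝ (Matrix.mulVecReal A).range := by
  have hker : (Matrix.mulVecReal (Aᴴ * A)).ker = (Matrix.mulVecReal A).ker := by
    ext x
    constructor
    · exact fun h => mulVec_eq_zero_of_gram_mulVec_eq_zero (A := A) h
    · intro h
      have h' : A *ᵥ x = 0 := h
      change (Aᴴ * A) *ᵥ x = 0
      rw [← Matrix.mulVec_mulVec, h', Matrix.mulVec_zero]
  have h1 := LinearMap.finrank_range_add_finrank_ker (Matrix.mulVecReal (Aᴴ * A))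
  have h2 := LinearMap.finrank_range_add_finrank_ker (Matrix.mulVecReal A)
  rw [hker] at h1
  omega

theorem range_mulVecReal_mul_le {η : Type*} [Fintype η] (A : Matrix η κ ℍ[ℝ])
    (B : Matrix κ ι ℍ[ℝ]) :
    (Matrix.mulVecReal (A * B)).range ≤ (Matrix.mulVecReal A).range := by
  rintro _ ⟨x, rfl⟩
  exact ⟨B *ᵥ x, A.mulVec_mulVec x B⟩

/-- The normal equations are solvable. -/
theorem exists_gram_mulVec_eq (A : Matrix κ ι ℍ[ℝ]) (w : κ → ℍ[ℝ]) :
    ∃ z : ι → ℍ[ℝ], (Aᴴ * A) *ᵥ z = Aᴴ *ᵥ w := by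
  -- $A^*A$ and $A$ have equal rank, as do $AA^*$ and $A^*$; since the range of $AA^*$ lies in that
  -- of $A$, the rank of $A^*$ is at most that of $A^*A$, which forces equal ranges.
  have h1 := finrank_range_mulVecReal_gram A
  have h2 := finrank_range_mulVecReal_gram Aᴴ
  rw [Matrix.conjTranspose_conjTranspose] at h2
  have h3 := Submodule.finrank_mono (range_mulVecReal_mul_le A Aᴴ)
  have h4 := Submodule.eq_of_le_of_finrank_le (range_mulVecReal_mul_le Aᴴ A) (by omega)
  have h5 : Aᴴ *ᵥ w ∈ (Matrix.mulVecReal Aᴴ).range := ⟨w, rfl⟩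
  rw [← h4] at h5
  exact h5

theorem posDefOn_gram {A : Matrix κ ι ℍ[ℝ]} {β : Finset ι}
    (h : ∀ x : ι → ℍ[ℝ], (∀ p, p ∉ β → x p = 0) → A *ᵥ x = 0 → x = 0) :
    PosDefOn β (Aᴴ * A) := by
  intro x hx hx0
  rw [star_dotProduct_gram_mulVec]
  exact (re_star_dotProduct_self_nonneg _).lt_of_ne fun hc =>
    hx0 (h x hx (re_star_dotProduct_self_eq_zero hc.symm))

variable [LinearOrder ι]

/-- These are the normal equations of `A` with the columns outside `δ` set to zero. -/
theorem exists_gram_mulVec_eq_on (A : Matrix κ ι ℍ[ℝ]) (w : κ → ℍ[ℝ]) (δ : Finset ι) :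
    ∃ z : ι → ℍ[ℝ], (∀ p, p ∉ δ → z p = 0) ∧ ∀ p ∈ δ, (Aᴴ *ᵥ w) p = ((Aᴴ * A) *ᵥ z) p := by
  let A' : Matrix κ ι ℍ[ℝ] := Matrix.of fun k p => if p ∈ δ then A k p else 0
  obtain ⟨z, hz⟩ := exists_gram_mulVec_eq A' w
  have hA : A *ᵥ (fun p => if p ∈ δ then z p else 0) = A' *ᵥ z := by
    ext1 k
    simp only [A', Matrix.mulVec, dotProduct, Matrix.of_apply]
    refine Finset.sum_congr rfl fun p _ => ?_
    split_ifs <;> simp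
  have hA' : ∀ y, ∀ p ∈ δ, (Aᴴ *ᵥ y) p = (A'ᴴ *ᵥ y) p := by
    intro y p hp
    simp only [A', Matrix.mulVec, dotProduct, Matrix.conjTranspose_apply, Matrix.of_apply, hp, if_true]
  refine ⟨fun p => if p ∈ δ then z p else 0, fun p hp => by simp [hp], fun p hp => ?_⟩
  rw [← Matrix.mulVec_mulVec, hA, hA' _ p hp, hA' _ p hp, Matrix.mulVec_mulVec, hz]

/-- $A^*A+tI$ is positive definite for $t>0$. The identities are closed conditions in $t$ and
survive at $t=0$, where positivity weakens to `0 ≤ d`. -/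
theorem exists_det_gram (A : Matrix κ ι ℍ[ℝ]) (β : Finset ι) :
    ∃ d : ℝ, 0 ≤ d ∧ detOn β (Aᴴ * A) = (d : ℍ[ℝ]) ∧
      ∀ i ∈ β, ∀ x v : ι → ℍ[ℝ], (∀ p, p ∉ β → x p = 0) →
        (∀ p ∈ β, v p = ((Aᴴ * A) *ᵥ x) p) →
        cdetOn β ((Aᴴ * A).updateCol i v) i = (d : ℍ[ℝ]) * x i := by
  let H : ℝ → Matrix ι ι ℍ[ℝ] := fun t => Aᴴ * A + t • 1
  have hHerm : ∀ t, (H t).IsHermitian := by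
    intro t
    refine (Matrix.isHermitian_conjTranspose_mul_self A).add ?_
    ext1 p q
    simp only [Matrix.conjTranspose_apply, Matrix.smul_apply, Quaternion.star_smul,
      Matrix.one_apply, eq_comm (a := q)]
    split_ifs <;> simp
  have hHmul : ∀ t x, H t *ᵥ x = (Aᴴ * A) *ᵥ x + t • x := by
    intro t x
    rw [Matrix.add_mulVec, Matrix.smul_mulVec, Matrix.one_mulVec]
  have hpos : ∀ t, 0 < t → PosDefOn β (H t) := by
    intro t ht x _ hx
    rw [hHmul, dotProduct_add, star_dotProduct_gram_mulVec, dotProduct_smul, Quaternion.re_add,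
      Quaternion.re_smul, smul_eq_mul]
    have h1 := re_star_dotProduct_self_nonneg (A *ᵥ x)
    have h2 := (re_star_dotProduct_self_nonneg x).lt_of_ne fun h =>
      hx (re_star_dotProduct_self_eq_zero h.symm)
    positivity
  have hcont : ∀ p q, Continuous fun t => H t p q := by
    intro p q
    simp only [H, Matrix.add_apply, Matrix.smul_apply]
    fun_prop
  have hdet := continuous_detOn hcont β
  have hre : Continuous fun t => (detOn β (H t)).re := Quaternion.continuous_re.comp hdet
  have h0 : (0 : ℝ) ∈ closure (Set.Ioi 0) := by simp
  have hH0 : H 0 = Aᴴ * A := by simp [H]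
  rw [← hH0]
  refine ⟨(detOn β (H 0)).re, ?_, ?_, ?_⟩
  · refine closure_minimal (fun t ht => ?_) (isClosed_le continuous_const hre) h0
    obtain ⟨d, hd, hd', -⟩ := (hpos t ht).exists_det (hHerm t)
    simp [hd', hd.le]
  · refine closure_minimal (t := {t | detOn β (H t) = (((detOn β (H t)).re : ℝ) : ℍ[ℝ])})
      (fun t ht => ?_) (isClosed_eq hdet (Quaternion.continuous_coe.comp hre)) h0
    obtain ⟨d, hd, hd', -⟩ := (hpos t ht).exists_det (hHerm t)
    simp [hd']
  · intro i hi x v hx hv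
    -- Only entries in `β` matter, so `v` may be replaced by `H 0 *ᵥ x`, which varies continuously
    -- as `H t *ᵥ x`.
    have hv' : cdetOn β ((H 0).updateCol i v) i = cdetOn β ((H 0).updateCol i (H 0 *ᵥ x)) i := by
      rw [cdetOn_updateCol_eq_sum _ hi, cdetOn_updateCol_eq_sum _ hi]
      exact Finset.sum_congr rfl fun l hl => by rw [hv l hl]
    rw [hv']
    refine closure_minimal (t := {t | cdetOn β ((H t).updateCol i (H t *ᵥ x)) i =
      (((detOn β (H t)).re : ℝ) : ℍ[ℝ]) * x i}) (fun t ht => ?_) (isClosed_eq ?_ ?_) h0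
    · obtain ⟨d, hd, hd', h⟩ := (hpos t ht).exists_det (hHerm t)
      rw [Set.mem_ofPred_eq, h i hi x _ hx fun _ _ => rfl, hd', Quaternion.re_coe]
    · refine continuous_cdetOn (fun p q => ?_) β i
      simp only [Matrix.updateCol_apply, hHmul, Pi.add_apply, Pi.smul_apply]
      split_ifs
      · fun_prop
      · exact hcont p q
    · exact (Quaternion.continuous_coe.comp hre).mul continuous_const

/-- Cramer's rule with the zero column gives $0=d\,x_i$ at an index where $x_i\ne0$. -/
theorem detOn_gram_eq_zero {A : Matrix κ ι ℍ[ℝ]} {β : Finset ι} {x : ι → ℍ[ℝ]}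
    (hx : ∀ p, p ∉ β → x p = 0) (hx0 : x ≠ 0) (h : A *ᵥ x = 0) : detOn β (Aᴴ * A) = 0 := by
  obtain ⟨d, -, hd, hform⟩ := exists_det_gram A β
  obtain ⟨i, hi⟩ := Function.ne_iff.1 hx0
  have hiβ : i ∈ β := by
    by_contra hc
    exact hi (hx i hc)
  have := hform i hiβ x 0 hx fun p _ => by
    rw [← Matrix.mulVec_mulVec, h, Matrix.mulVec_zero]
  rw [cdetOn_updateCol_eq_sum _ hiβ] at this
  simp only [Pi.zero_apply, mul_zero, Finset.sum_const_zero] at this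
  rw [hd]
  exact (mul_eq_zero.1 this.symm).resolve_right hi

theorem cdetOn_gram_updateCol_mulVec (A : Matrix κ ι ℍ[ℝ]) {β : Finset ι} {i : ι} (hi : i ∈ β)
    (x : ι → ℍ[ℝ]) :
    cdetOn β ((Aᴴ * A).updateCol i ((Aᴴ * A) *ᵥ x)) i = detOn β (Aᴴ * A) * x i +
      ∑ l ∈ βᶜ, cdetOn β ((Aᴴ * A).updateCol i fun k => (Aᴴ * A) k l) i * x l := by
  have hlin : cdetOn β ((Aᴴ * A).updateCol i ((Aᴴ * A) *ᵥ x)) i =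
      ∑ l, cdetOn β ((Aᴴ * A).updateCol i fun k => (Aᴴ * A) k l) i * x l := by
    simp only [cdetOn_updateCol_eq_sum _ hi, Finset.sum_mul]
    rw [Finset.sum_comm]
    refine Finset.sum_congr rfl fun k _ => ?_
    simp only [Matrix.mulVec, dotProduct, Finset.mul_sum, mul_assoc]
  rw [hlin, ← Finset.sum_add_sum_compl β]
  congr 1
  obtain ⟨d, -, hd, hform⟩ := exists_det_gram A β
  have hcol : ∀ l ∈ β, cdetOn β ((Aᴴ * A).updateCol i fun k => (Aᴴ * A) k l) i =
      (d : ℍ[ℝ]) * (Pi.single l 1 : ι → ℍ[ℝ]) i := by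
    intro l hl
    refine hform i hi _ _ (fun p hp => ?_) fun p _ => by simp
    rw [Pi.single_apply, if_neg]
    rintro rfl
    exact hp hl
  rw [Finset.sum_eq_single i]
  · rw [hcol i hi, hd, Pi.single_eq_same, mul_one]
  · intro l hl hli
    rw [hcol l hl, Pi.single_eq_of_ne hli.symm, mul_zero, zero_mul]
  · exact fun h => absurd hi h

/-- On `δ` the column $A^*w$ is in the range of the block, so Cramer's rule makes its column
determinant a multiple of the zero minor. Expanding that determinant by cofactors gives the
relation. -/
theorem detOn_erase_mul_eq_sum (A : Matrix κ ι ℍ[ℝ]) (w : κ → ℍ[ℝ]) {δ : Finset ι} {i : ι}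
    (hi : i ∈ δ) (hδ : detOn δ (Aᴴ * A) = 0) :
    detOn (δ.erase i) (Aᴴ * A) * (Aᴴ *ᵥ w) i = ∑ l ∈ δ.erase i,
      cdetOn (δ.erase l) ((Aᴴ * A).updateCol i fun k => (Aᴴ * A) k l) i * (Aᴴ *ᵥ w) l := by
  obtain ⟨z, hz, hzw⟩ := exists_gram_mulVec_eq_on A w δ
  obtain ⟨d, -, hd, hform⟩ := exists_det_gram A δ
  have h := hform i hi z (Aᴴ *ᵥ w) hz hzw
  rw [← hd, hδ, zero_mul, cdetOn_updateCol_eq_sum _ hi, ← Finset.add_sum_erase _ _ hi,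
    cofactorOn_self] at h
  rw [eq_neg_of_add_eq_zero_left h, ← Finset.sum_neg_distrib]
  refine Finset.sum_congr rfl fun l hl => ?_
  obtain ⟨hli, hl⟩ := Finset.mem_erase.1 hl
  rw [cofactorOn_of_ne _ hi hl hli.symm, neg_mul, neg_neg]

/-- Cramer's rule for the solution of the normal equations in the range of `Aᴴ`. -/
theorem sum_cdetOn_gram_updateCol (A : Matrix κ ι ℍ[ℝ]) (w : κ → ℍ[ℝ]) (r : ℕ)
    (hr : ∀ δ : Finset ι, δ.card = r + 1 → detOn δ (Aᴴ * A) = 0) (i : ι) :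
    ∑ β : Finset ι with β.card = r ∧ i ∈ β,
        cdetOn β ((Aᴴ * A).updateCol i ((Aᴴ * A) *ᵥ (Aᴴ *ᵥ w))) i =
      (∑ β : Finset ι with β.card = r, detOn β (Aᴴ * A)) * (Aᴴ *ᵥ w) i := by
  obtain ⟨x, hx⟩ : ∃ x, x = Aᴴ *ᵥ w := ⟨_, rfl⟩
  let Φ : Finset ι → ι → ℍ[ℝ] := fun β l =>
    cdetOn β ((Aᴴ * A).updateCol i fun k => (Aᴴ * A) k l) i * x l
  -- A set with an outside index is the same as the enlarged set with a marked index other than `i`.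
  have hsum1 : ∑ β : Finset ι with β.card = r ∧ i ∈ β, ∑ l ∈ βᶜ, Φ β l =
      ∑ δ : Finset ι with δ.card = r + 1 ∧ i ∈ δ, ∑ l ∈ δ.erase i, Φ (δ.erase l) l := by
    rw [Finset.sum_sigma', Finset.sum_sigma']
    refine Finset.sum_bij' (fun p _ => ⟨insert p.2 p.1, p.2⟩) (fun p _ => ⟨p.1.erase p.2, p.2⟩)
      ?_ ?_ ?_ ?_ ?_
    · rintro ⟨β, l⟩ h
      simp only [Finset.mem_sigma, Finset.mem_filter, Finset.mem_univ, true_and,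
        Finset.mem_compl] at h ⊢
      obtain ⟨⟨hc, hi⟩, hl⟩ := h
      refine ⟨⟨by rw [Finset.card_insert_of_notMem hl, hc], Finset.mem_insert_of_mem hi⟩, ?_⟩
      refine Finset.mem_erase.2 ⟨?_, Finset.mem_insert_self _ _⟩
      rintro rfl
      exact hl hi
    · rintro ⟨δ, l⟩ h
      simp only [Finset.mem_sigma, Finset.mem_filter, Finset.mem_univ, true_and,
        Finset.mem_compl, Finset.mem_erase] at h ⊢
      obtain ⟨⟨hc, hi⟩, hli, hl⟩ := h
      exact ⟨⟨by rw [Finset.card_erase_of_mem hl, hc, Nat.add_sub_cancel], Ne.symm hli, hi⟩,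
        fun h => h.1 rfl⟩
    · rintro ⟨β, l⟩ h
      simp only [Finset.mem_sigma, Finset.mem_compl] at h
      simp [Finset.erase_insert h.2]
    · rintro ⟨δ, l⟩ h
      simp only [Finset.mem_sigma, Finset.mem_erase] at h
      simp [Finset.insert_erase h.2.2]
    · rintro ⟨β, l⟩ h
      simp only [Finset.mem_sigma, Finset.mem_compl] at h
      simp [Finset.erase_insert h.2]
  have hsum2 : ∑ δ : Finset ι with δ.card = r + 1 ∧ i ∈ δ, detOn (δ.erase i) (Aᴴ * A) =
      ∑ β : Finset ι with β.card = r ∧ i ∉ β, detOn β (Aᴴ * A) := by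
    refine Finset.sum_bij' (fun δ _ => δ.erase i) (fun β _ => insert i β) ?_ ?_ ?_ ?_ ?_
    · intro δ h
      simp only [Finset.mem_filter, Finset.mem_univ, true_and] at h ⊢
      exact ⟨by rw [Finset.card_erase_of_mem h.2, h.1, Nat.add_sub_cancel], by simp⟩
    · intro β h
      simp only [Finset.mem_filter, Finset.mem_univ, true_and] at h ⊢
      exact ⟨by rw [Finset.card_insert_of_notMem h.2, h.1], by simp⟩
    · intro δ h
      exact Finset.insert_erase (Finset.mem_filter.1 h).2.2
    · intro β h
      exact Finset.erase_insert (Finset.mem_filter.1 h).2.2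
    · intro δ _
      rfl
  rw [← hx]
  calc ∑ β : Finset ι with β.card = r ∧ i ∈ β, cdetOn β ((Aᴴ * A).updateCol i ((Aᴴ * A) *ᵥ x)) i
      = ∑ β : Finset ι with β.card = r ∧ i ∈ β, (detOn β (Aᴴ * A) * x i + ∑ l ∈ βᶜ, Φ β l) :=
        Finset.sum_congr rfl fun β hβ =>
          cdetOn_gram_updateCol_mulVec A (Finset.mem_filter.1 hβ).2.2 x
    _ = ∑ β : Finset ι with β.card = r ∧ i ∈ β, detOn β (Aᴴ * A) * x i +
        ∑ δ : Finset ι with δ.card = r + 1 ∧ i ∈ δ, detOn (δ.erase i) (Aᴴ * A) * x i := by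
        rw [Finset.sum_add_distrib, hsum1]
        congr 1
        refine Finset.sum_congr rfl fun δ hδ => ?_
        obtain ⟨-, hc, hi⟩ := Finset.mem_filter.1 hδ
        rw [hx, detOn_erase_mul_eq_sum A w hi (hr δ hc), ← hx]
    _ = (∑ β : Finset ι with β.card = r, detOn β (Aᴴ * A)) * x i := by
        rw [← Finset.sum_mul, ← Finset.sum_mul, hsum2, ← add_mul, ← Finset.filter_filter,
          ← Finset.filter_filter, Finset.sum_filter_add_sum_filter_not]

end Gram

/-! ### The Moore–Penrose inverse and least squares. -/

section MoorePenrose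

variable {m n s : ℕ} {A : Matrix (Fin m) (Fin n) ℍ[ℝ]} {P : Matrix (Fin n) (Fin m) ℍ[ℝ]}

theorem exists_gram_mul_eq (A : Matrix (Fin m) (Fin n) ℍ[ℝ]) :
    ∃ Z : Matrix (Fin n) (Fin m) ℍ[ℝ], Aᴴ * A * Z = Aᴴ := by
  choose z hz using fun j : Fin m => exists_gram_mulVec_eq A (Pi.single j 1)
  refine ⟨Matrix.of fun p j => z j p, ?_⟩
  ext1 p j
  have := congrFun (hz j) p
  rw [Matrix.mulVec_single_one] at this
  exact this

/-- From $A^*AZ=A^*$ and $AA^*W=A$, both $AZ$ and $W^*A$ are Hermitian, with $AZA=A=AW^*A$. Then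
$P=W^*AZ$ has $AP=AZ$ and $PA=W^*A$. -/
theorem exists_isMoorePenroseInverse (A : Matrix (Fin m) (Fin n) ℍ[ℝ]) :
    ∃ P, IsMoorePenroseInverse A P := by
  obtain ⟨Z, hZ⟩ := exists_gram_mul_eq A
  obtain ⟨W, hW⟩ := exists_gram_mul_eq Aᴴ
  rw [Matrix.conjTranspose_conjTranspose] at hW
  have hZ' : Zᴴ * Aᴴ * A = A := by
    simpa [Matrix.conjTranspose_mul, Matrix.mul_assoc] using congrArg Matrix.conjTranspose hZ
  have hZherm : (A * Z)ᴴ = A * Z := by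
    have : (A * Z)ᴴ * (A * Z) = A * Z := by
      rw [Matrix.conjTranspose_mul, ← Matrix.mul_assoc, hZ']
    rw [← this, Matrix.conjTranspose_mul, Matrix.conjTranspose_conjTranspose]
  have hAZA : A * Z * A = A := by
    rw [← hZherm, Matrix.conjTranspose_mul, hZ']
  have hY : Wᴴ * A * Aᴴ = Aᴴ := by
    simpa [Matrix.conjTranspose_mul, Matrix.mul_assoc] using congrArg Matrix.conjTranspose hW
  have hYherm : (Wᴴ * A)ᴴ = Wᴴ * A := by
    have : Wᴴ * A * (Wᴴ * A)ᴴ = (Wᴴ * A)ᴴ := by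
      rw [Matrix.conjTranspose_mul, ← Matrix.mul_assoc, hY]
    have h' := congrArg Matrix.conjTranspose this
    rw [Matrix.conjTranspose_mul, Matrix.conjTranspose_conjTranspose, this] at h'
    exact h'
  have hAYA : A * (Wᴴ * A) = A := by
    rw [← hYherm, Matrix.conjTranspose_mul, Matrix.conjTranspose_conjTranspose,
      ← Matrix.mul_assoc, hW]
  have h1 : A * (Wᴴ * A * Z) = A * Z := by rw [← Matrix.mul_assoc, hAYA]
  have h2 : Wᴴ * A * Z * A = Wᴴ * A := by
    rw [Matrix.mul_assoc, Matrix.mul_assoc, ← Matrix.mul_assoc A, hAZA]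
  refine ⟨Wᴴ * A * Z, ?_, ?_, ?_, ?_⟩
  · rw [h1, hZherm]
  · rw [h2, hYherm]
  · rw [h1, hAZA]
  · rw [h2, ← Matrix.mul_assoc, Matrix.mul_assoc Wᴴ A, hAYA]

namespace IsMoorePenroseInverse

theorem gram_mul (h : IsMoorePenroseInverse A P) : Aᴴ * A * P = Aᴴ := by
  rw [Matrix.mul_assoc, ← h.conj_left, ← Matrix.conjTranspose_mul, h.mul_mul_self]

theorem mul_gram (h : IsMoorePenroseInverse A P) : P * A * Aᴴ = Aᴴ := by
  rw [← h.conj_right, ← Matrix.conjTranspose_mul, ← Matrix.mul_assoc, h.mul_mul_self]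

theorem eq_conjTranspose_mul (h : IsMoorePenroseInverse A P) : P = Aᴴ * (Pᴴ * P) := by
  rw [← Matrix.mul_assoc, ← Matrix.conjTranspose_mul, h.conj_right, h.self_mul_mul]

theorem unique {Q : Matrix (Fin n) (Fin m) ℍ[ℝ]} (hP : IsMoorePenroseInverse A P)
    (hQ : IsMoorePenroseInverse A Q) : P = Q := by
  have h1 : A * P = A * Q := by
    have : A * Q * (A * P) = A * Q := by
      rw [← hQ.conj_left, Matrix.conjTranspose_mul, Matrix.mul_assoc, ← Matrix.mul_assoc Aᴴ,
        hP.gram_mul]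
    rw [← this, ← Matrix.mul_assoc, hQ.mul_mul_self]
  have h2 : P * A = Q * A := by
    have : P * A * (Q * A) = Q * A := by
      rw [← hQ.conj_right, Matrix.conjTranspose_mul, ← Matrix.mul_assoc, hP.mul_gram]
    rw [← this, Matrix.mul_assoc, ← Matrix.mul_assoc A, hQ.mul_mul_self]
  rw [← hP.self_mul_mul, h2, Matrix.mul_assoc, h1, ← Matrix.mul_assoc, hQ.self_mul_mul]

end IsMoorePenroseInverse

attribute [local instance] Matrix.frobeniusNormedAddCommGroup

theorem frobenius_norm_sq {κ ι : Type*} [Fintype κ] [Fintype ι] (M : Matrix κ ι ℍ[ℝ]) :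
    ‖M‖ ^ 2 = ∑ j, ∑ i, ‖M i j‖ ^ 2 := by
  rw [Matrix.frobenius_norm_def, ← Real.sqrt_eq_rpow, Real.sq_sqrt, Finset.sum_comm]
  · simp only [Real.rpow_two]
  · positivity

theorem Quaternion.norm_add_sq (a b : ℍ[ℝ]) :
    ‖a + b‖ ^ 2 = ‖a‖ ^ 2 + ‖b‖ ^ 2 + 2 * (star a * b).re := by
  simp only [sq, ← Quaternion.normSq_eq_norm_mul_self, Quaternion.normSq_def', Quaternion.re_add,
    Quaternion.imI_add, Quaternion.imJ_add, Quaternion.imK_add, Quaternion.re_mul,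
    Quaternion.re_star, Quaternion.imI_star, Quaternion.imJ_star, Quaternion.imK_star]
  ring

theorem frobenius_norm_add_sq {κ ι : Type*} [Fintype κ] [Fintype ι] {M N : Matrix κ ι ℍ[ℝ]}
    (h : Mᴴ * N = 0) : ‖M + N‖ ^ 2 = ‖M‖ ^ 2 + ‖N‖ ^ 2 := by
  simp only [frobenius_norm_sq, Matrix.add_apply, Quaternion.norm_add_sq, Finset.sum_add_distrib,
    ← Finset.mul_sum]
  have h0 : ∀ j, ∑ i, (star (M i j) * N i j).re = 0 := by
    intro j
    have h1 : (∑ i, star (M i j) * N i j).re = 0 := by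
      have h2 := congrFun (congrFun h j) j
      rw [Matrix.mul_apply] at h2
      simp only [Matrix.conjTranspose_apply] at h2
      rw [h2]
      rfl
    rw [← Quaternion.re_sum]
    exact h1
  rw [Finset.sum_congr rfl fun j _ => h0 j, Finset.sum_const_zero, mul_zero, add_zero]

/-- Pythagoras: $A^*(APB-B)=0$, so the residual at $PB$ is orthogonal to the range of $A$. -/
theorem IsMoorePenroseInverse.norm_residual_sq (h : IsMoorePenroseInverse A P)
    (B : Matrix (Fin m) (Fin s) ℍ[ℝ]) (Y : Matrix (Fin n) (Fin s) ℍ[ℝ]) :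
    ‖A * Y - B‖ ^ 2 = ‖A * Y - A * (P * B)‖ ^ 2 + ‖A * (P * B) - B‖ ^ 2 := by
  rw [← frobenius_norm_add_sq, sub_add_sub_cancel]
  rw [← Matrix.mul_sub, Matrix.conjTranspose_mul, Matrix.mul_assoc, Matrix.mul_sub,
    ← Matrix.mul_assoc Aᴴ, ← Matrix.mul_assoc, h.gram_mul, sub_self, Matrix.mul_zero]

theorem IsMoorePenroseInverse.isLeastSquaresSolution_iff (h : IsMoorePenroseInverse A P)
    (B : Matrix (Fin m) (Fin s) ℍ[ℝ]) (Y : Matrix (Fin n) (Fin s) ℍ[ℝ]) :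
    IsLeastSquaresSolution A B Y ↔ A * Y = A * (P * B) := by
  constructor
  · intro hY
    have h1 := pow_le_pow_left₀ (norm_nonneg _) (hY (P * B)) 2
    rw [h.norm_residual_sq B Y] at h1
    have h2 : ‖A * Y - A * (P * B)‖ ^ 2 = 0 := le_antisymm (by linarith) (sq_nonneg _)
    exact sub_eq_zero.1 (norm_eq_zero.1 (pow_eq_zero_iff two_ne_zero |>.1 h2))
  · intro hY Z
    rw [hY, ← pow_le_pow_iff_left₀ (norm_nonneg _) (norm_nonneg _) two_ne_zero,
      h.norm_residual_sq B Z]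
    linarith [sq_nonneg ‖A * Z - A * (P * B)‖]

/-- Pythagoras again: $PB$ lies in the range of $A^*$, which is orthogonal to the kernel of $A$. -/
theorem IsMoorePenroseInverse.norm_sq_of_mul_eq (h : IsMoorePenroseInverse A P)
    {B : Matrix (Fin m) (Fin s) ℍ[ℝ]} {Y : Matrix (Fin n) (Fin s) ℍ[ℝ]}
    (hY : A * Y = A * (P * B)) : ‖Y‖ ^ 2 = ‖Y - P * B‖ ^ 2 + ‖P * B‖ ^ 2 := by
  rw [← frobenius_norm_add_sq, sub_add_cancel]
  have hPB : P * B = Aᴴ * (Pᴴ * P * B) := by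
    rw [← Matrix.mul_assoc, ← h.eq_conjTranspose_mul]
  calc (Y - P * B)ᴴ * (P * B) = (A * (Y - P * B))ᴴ * (Pᴴ * P * B) := by
        rw [Matrix.conjTranspose_mul, Matrix.mul_assoc, ← hPB]
    _ = 0 := by
        rw [Matrix.mul_sub, hY, sub_self, Matrix.conjTranspose_zero, Matrix.zero_mul]

theorem IsMoorePenroseInverse.isMinNormLeastSquaresSolution (h : IsMoorePenroseInverse A P)
    (B : Matrix (Fin m) (Fin s) ℍ[ℝ]) : IsMinNormLeastSquaresSolution A B (P * B) := by
  refine ⟨(h.isLeastSquaresSolution_iff B _).2 rfl, fun Y hY => ?_⟩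
  rw [← pow_le_pow_iff_left₀ (norm_nonneg _) (norm_nonneg _) two_ne_zero,
    h.norm_sq_of_mul_eq ((h.isLeastSquaresSolution_iff B Y).1 hY)]
  linarith [sq_nonneg ‖Y - P * B‖]

theorem IsMoorePenroseInverse.eq_of_isMinNormLeastSquaresSolution (h : IsMoorePenroseInverse A P)
    {B : Matrix (Fin m) (Fin s) ℍ[ℝ]} {X : Matrix (Fin n) (Fin s) ℍ[ℝ]}
    (hX : IsMinNormLeastSquaresSolution A B X) : X = P * B := by
  have h1 : ‖X‖ ≤ ‖P * B‖ := hX.2 _ ((h.isLeastSquaresSolution_iff B _).2 rfl)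
  have h2 := pow_le_pow_left₀ (norm_nonneg _) h1 2
  rw [h.norm_sq_of_mul_eq ((h.isLeastSquaresSolution_iff B X).1 hX.1)] at h2
  have h3 : ‖X - P * B‖ ^ 2 = 0 := le_antisymm (by linarith) (sq_nonneg _)
  exact sub_eq_zero.1 (norm_eq_zero.1 (pow_eq_zero_iff two_ne_zero |>.1 h3))

end MoorePenrose

/-! ### Rank and right linear independence of columns. -/

section Rank

variable {m n : ℕ}

theorem mulVec_eq_sum_op_smul (A : Matrix (Fin m) (Fin n) ℍ[ℝ]) (x : Fin n → ℍ[ℝ]) :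
    A *ᵥ x = ∑ j, MulOpposite.op (x j) • fun k => A k j := by
  ext1 k
  simp [Matrix.mulVec, dotProduct]

theorem exists_mulVec_eq_zero_of_quatRank_lt (A : Matrix (Fin m) (Fin n) ℍ[ℝ])
    {δ : Finset (Fin n)} (hδ : quatRank A < δ.card) :
    ∃ x : Fin n → ℍ[ℝ], (∀ p, p ∉ δ → x p = 0) ∧ x ≠ 0 ∧ A *ᵥ x = 0 := by
  have hdep : ¬ LinearIndependent ℍ[ℝ]ᵐᵒᵖ fun j : δ => fun k => A k j := by
    intro hli
    have h1 := finrank_span_eq_card hli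
    have hfin : Module.Finite ℍ[ℝ]ᵐᵒᵖ
        (Submodule.span ℍ[ℝ]ᵐᵒᵖ (Set.range fun j : Fin n => fun i => A i j)) :=
      Module.Finite.span_of_finite _ (Set.finite_range _)
    have h2 := Submodule.finrank_mono (Submodule.span_mono (R := ℍ[ℝ]ᵐᵒᵖ)
      (Set.range_comp_subset_range (Subtype.val : δ → Fin n) fun j : Fin n => fun i => A i j))
    rw [Fintype.card_coe] at h1
    exact absurd (h1.symm.trans_le h2) (not_le.2 hδ)
  obtain ⟨g, hg, ⟨j, hj⟩, hgj⟩ := Fintype.not_linearIndependent_iff.1 hdep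
  refine ⟨fun p => if h : p ∈ δ then (g ⟨p, h⟩).unop else 0, fun p hp => by simp [hp], ?_, ?_⟩
  · refine Function.ne_iff.2 ⟨j, ?_⟩
    simpa [hj] using hgj
  · rw [mulVec_eq_sum_op_smul, ← hg, ← Finset.sum_subset (Finset.subset_univ δ),
      ← Finset.sum_coe_sort]
    · simp
    · intro p _ hp
      simp [hp]

/-- `β` indexes a right basis of the column space chosen among the columns. -/
theorem exists_card_eq_quatRank (A : Matrix (Fin m) (Fin n) ℍ[ℝ]) :
    ∃ β : Finset (Fin n), β.card = quatRank A ∧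
      ∀ x : Fin n → ℍ[ℝ], (∀ p, p ∉ β → x p = 0) → A *ᵥ x = 0 → x = 0 := by
  obtain ⟨κ, a, ha, hspan, hli⟩ :=
    exists_linearIndependent' ℍ[ℝ]ᵐᵒᵖ fun j : Fin n => fun k => A k j
  have : Fintype κ := Fintype.ofInjective a ha
  refine ⟨Finset.univ.map ⟨a, ha⟩, ?_, fun x hx h => ?_⟩
  · rw [Finset.card_map, Finset.card_univ, quatRank, ← hspan, finrank_span_eq_card hli]
  · rw [mulVec_eq_sum_op_smul, ← Finset.sum_subset (Finset.subset_univ (Finset.univ.map ⟨a, ha⟩)),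
      Finset.sum_map] at h
    · ext1 p
      by_cases hp : p ∈ Finset.univ.map ⟨a, ha⟩
      · obtain ⟨k, -, rfl⟩ := Finset.mem_map.1 hp
        exact congrArg MulOpposite.unop (Fintype.linearIndependent_iff.1 hli _ h k)
      · exact hx p hp
    · intro p _ hp
      simp [hx p hp]

end Rank

/-! ### The determinantal representation. -/

theorem sumPrincipalMinors_eq {n : ℕ} (r : ℕ) (H : Matrix (Fin n) (Fin n) ℍ[ℝ]) :
    sumPrincipalMinors r H = ∑ β : Finset (Fin n) with β.card = r, detOn β H := by
  rw [sumPrincipalMinors, Finset.sum_subtype (p := fun β : Finset (Fin n) => β.card = r) _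
    (by simp)]
  exact Finset.sum_congr rfl fun β _ => hermDet_principalSubmatrix β.1 H

theorem sumPrincipalCdet_eq {R : Type*} [Ring R] {n : ℕ} (r : ℕ) (M : Matrix (Fin n) (Fin n) R)
    (i : Fin n) :
    sumPrincipalCdet r M i = ∑ β : Finset (Fin n) with β.card = r ∧ i ∈ β, cdetOn β M i := by
  rw [sumPrincipalCdet, Finset.sum_subtype (p := fun β : Finset (Fin n) => β.card = r ∧ i ∈ β) _
    (by simp)]
  exact Finset.sum_congr rfl fun β _ => cdet_principalSubmatrix β.1 M ⟨i, β.2.2⟩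

/-- All the minors are nonnegative, and the one on a basis of columns is positive. -/
theorem exists_sumPrincipalMinors_gram {m n : ℕ} (A : Matrix (Fin m) (Fin n) ℍ[ℝ]) :
    ∃ d : ℝ, 0 < d ∧ sumPrincipalMinors (quatRank A) (Aᴴ * A) = (d : ℍ[ℝ]) := by
  choose d hd0 hd _ using exists_det_gram A
  obtain ⟨β, hβ, hli⟩ := exists_card_eq_quatRank A
  obtain ⟨e, he, he', -⟩ :=
    (posDefOn_gram hli).exists_det (Matrix.isHermitian_conjTranspose_mul_self A) β
  have hde : d β = e := by rw [← Quaternion.coe_inj, ← hd, he']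
  refine ⟨∑ β : Finset (Fin n) with β.card = quatRank A, d β, ?_, ?_⟩
  · exact Finset.sum_pos' (fun β _ => hd0 β) ⟨β, by simp [hβ], hde ▸ he⟩
  · rw [sumPrincipalMinors_eq, Finset.sum_congr rfl fun β _ => hd β]
    exact (map_sum (algebraMap ℝ ℍ[ℝ]) _ _).symm

theorem Quaternion.eq_div_coe {a x : ℍ[ℝ]} {d : ℝ} (hd : d ≠ 0) (h : a = (d : ℍ[ℝ]) * x) :
    x = a / (d : ℍ[ℝ]) := by
  have hd' : (d : ℍ[ℝ]) ≠ 0 := fun hc => hd (Quaternion.coe_inj.1 (hc.trans Quaternion.coe_zero.symm))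
  rw [h, (Quaternion.coe_commutes d x), mul_div_assoc, div_self hd', mul_one]

theorem theorem4p2 (m n s : ℕ) (A : Matrix (Fin m) (Fin n) ℍ[ℝ])
    (B : Matrix (Fin m) (Fin s) ℍ[ℝ]) :
    (∃! P : Matrix (Fin n) (Fin m) ℍ[ℝ], IsMoorePenroseInverse A P) ∧
    (∃! X : Matrix (Fin n) (Fin s) ℍ[ℝ], IsMinNormLeastSquaresSolution A B X) ∧
    ∀ (P : Matrix (Fin n) (Fin m) ℍ[ℝ]) (X : Matrix (Fin n) (Fin s) ℍ[ℝ]),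
      IsMoorePenroseInverse A P → IsMinNormLeastSquaresSolution A B X →
      X = P * B ∧
      (∀ r : ℕ, quatRank A = r → r ≤ m → m < n →
        ∃ d : ℝ, d ≠ 0 ∧ sumPrincipalMinors r (Aᴴ * A) = (d : ℍ[ℝ]) ∧
          ∀ (i : Fin n) (j : Fin s),
            X i j = sumPrincipalCdet r ((Aᴴ * A).updateCol i (fun k => (Aᴴ * B) k j)) i /
              sumPrincipalMinors r (Aᴴ * A)) ∧
      (quatRank A = n →
        ∃ d : ℝ, d ≠ 0 ∧ ddet A = (d : ℍ[ℝ]) ∧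
          ∀ (i : Fin n) (j : Fin s),
            X i j = cdet ((Aᴴ * A).updateCol i (fun k => (Aᴴ * B) k j)) i / ddet A) := by
  obtain ⟨P₀, hP₀⟩ := exists_isMoorePenroseInverse A
  refine ⟨⟨P₀, hP₀, fun Q hQ => hQ.unique hP₀⟩,
    ⟨P₀ * B, hP₀.isMinNormLeastSquaresSolution B,
      fun X hX => hP₀.eq_of_isMinNormLeastSquaresSolution hX⟩, fun P X hP hX => ?_⟩
  have hXP := hP.eq_of_isMinNormLeastSquaresSolution hX
  -- Minimal norm enters here: $P=A^*P^*P$ places the columns of $X$ in the range of $A^*$.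
  have hrange : ∀ j, (fun p => X p j) = Aᴴ *ᵥ fun k => (Pᴴ * P * B) k j := by
    intro j
    have : X = Aᴴ * (Pᴴ * P * B) := by rw [hXP, ← Matrix.mul_assoc, ← hP.eq_conjTranspose_mul]
    rw [this]
    rfl
  have hnormal : ∀ j, (fun k => (Aᴴ * B) k j) = (Aᴴ * A) *ᵥ fun p => X p j := by
    intro j
    have : Aᴴ * B = Aᴴ * A * X := by rw [hXP, ← Matrix.mul_assoc, hP.gram_mul]
    rw [this]
    rfl
  refine ⟨hXP, ?_, fun hr => ?_⟩
  · rintro r rfl - -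
    obtain ⟨d, hd, hd'⟩ := exists_sumPrincipalMinors_gram A
    refine ⟨d, hd.ne', hd', fun i j => ?_⟩
    rw [hd']
    refine Quaternion.eq_div_coe hd.ne' ?_
    rw [← hd', hnormal, hrange, sumPrincipalCdet_eq, sumPrincipalMinors_eq,
      congrFun (hrange j) i]
    convert sum_cdetOn_gram_updateCol A (fun k => (Pᴴ * P * B) k j) (quatRank A)
      (fun δ hδ => ?_) i
    obtain ⟨x, hx, hx0, hAx⟩ :=
      exists_mulVec_eq_zero_of_quatRank_lt A (δ := δ) (by omega)
    exact detOn_gram_eq_zero hx hx0 hAx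
  · obtain ⟨β, hβ, hli⟩ := exists_card_eq_quatRank A
    have hβ' : β = Finset.univ := by rw [← Finset.card_eq_iff_eq_univ, hβ, hr, Fintype.card_fin]
    subst hβ'
    obtain ⟨d, hd, hdet, hform⟩ :=
      (posDefOn_gram hli).exists_det (Matrix.isHermitian_conjTranspose_mul_self A) _
    have hd' : ddet A = (d : ℍ[ℝ]) := by rw [ddet, hermDet_eq_detOn_univ, hdet]
    refine ⟨d, hd.ne', hd', fun i j => ?_⟩
    rw [hd']
    refine Quaternion.eq_div_coe hd.ne' ?_
    rw [hnormal, cdet_eq_cdetOn_univ]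
    convert hform i (Finset.mem_univ i) (fun p => X p j) _ (by simp) fun p _ => rfl
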